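/- **Setting.** Let $J\subset\mathbb R^d$ be a compact set with nonempty interior, and let $(n_k)_{k\ge1}$ be integers and $(r_k)_{k\ge1}$ real numbers with $n_k\ge 2$, $0<r_k<1$, $n_kr_k\le 1$ and $r:=\inf_k r_k>0$. Let $D_k=\prod_{j=1}^k\{1,\dots,n_j\}$ be the set of words of length $k$ ($D_0=\{\emptyset\}$), $D=\bigcup_{k\ge0}D_k$, and let $\{J_{\mathbf i}\}_{\mathbf i\in D}$ be a family of sets with the Moran structure: $J_\emptyset=J$; each $J_{\mathbf i}$ is the image of $J$ under a similarity of $\mathbb R^d$; for $\mathbf i\in D_{k-1}$ the sets $J_{\mathbf i1},\dots,J_{\mathbf in_k}$ are subsets of $J_{\mathbf i}$ with pairwise disjoint interiors; and $|J_{\mathbf ij}|/|J_{\mathbf i}|=r_k$ for $\mathbf i\in D_{k-1}$, $1\le j\le n_k$, where $|A|$ is the diameter of $A$. Let $E=\bigcap_{k\ge0}\bigcup_{\mathbf i\in D_k}J_{\mathbf i}$ be the Moran set. Let $X_0=\{\emptyset\}$, $X_N=\{i_1\cdots i_k\in D: r_1\cdots r_k\le r^N<r_1\cdots r_{k-1}\}$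 for $N\ge1$, and $X=\bigcup_{N\ge0}X_N$. The augmented tree is the graph on $X$ with root $o=\emptyset$ whose edges are the vertical edges, joining each $\mathbf u\in X_{N+1}$ to its prefix in $X_N$, and the horizontal edges, joining distinct $\mathbf u,\mathbf v\in X_N$ ($N\ge1$) with $J_{\mathbf u}\cap J_{\mathbf v}\ne\emptyset$. Let $d$ be the graph distance, $|x|=d(o,x)$ and $|x\wedge y|=\frac12(|x|+|y|-d(x,y))$. A connected graph is *hyperbolic* if there is $\delta>0$, called a hyperbolicity constant, with $|x\wedge y|\ge\min\{|x\wedge z|,|z\wedge y|\}-\delta$ for all $x,y,z$. Given a hyperbolicity constant $\delta$ and $a>0$ with $e^{\delta a}-1<\sqrt2-1$, let $\rho_a(x,y)=e^{-a|x\wedge y|}$ for $x\ne y$ and $\rho_a(x,x)=0$. The sets $\{(x,y):\rho_a(x,y)<\varepsilon\}$, $\varepsilon>0$, are a base of a uniform structure on $X$. Let $\hat X$ be the completion of $X$ for it, and let $\partial X=\hat X\setminus X$ be the hyperbolic boundary, with the topology induced by $\hat X$. Extend $\rho_a$ to $\partial X$ by $\rho_a(\xi,\eta)=\limsup\rho_a(x,y)$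 as $x\to\xi$, $y\to\eta$ with $x,y\in X$. Condition (H): there is $C'>0$ such that for all $N\ge1$ and $\mathbf u,\mathbf v\in X_N$, either $J_{\mathbf u}\cap J_{\mathbf v}\ne\emptyset$ or $\operatorname{dist}(J_{\mathbf u},J_{\mathbf v})\ge C'r^N$. **Theorem 1.2.** (i) The augmented tree is connected and hyperbolic. (ii) For every hyperbolicity constant $\delta$ and every $a>0$ with $e^{\delta a}-1<\sqrt2-1$, put $\alpha=-\log r/a$. There is a homeomorphism $\Phi:\partial X\to E$ such that, for some $C>0$, $$|\Phi(\xi)-\Phi(\eta)|\le C\,\rho_a(\xi,\eta)^\alpha\qquad\text{for all }\xi,\eta\in\partial X,$$ and, if condition (H) holds, this same $\Phi$ satisfies, for some $C>0$, $$C^{-1}|\Phi(\xi)-\Phi(\eta)|\le\rho_a(\xi,\eta)^\alpha\le C\,|\Phi(\xi)-\Phi(\eta)|\qquad\text{for all }\xi,\eta\in\partial X.$$ -/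

import Mathlib

open Set Filter Topology

/-! ### Hyperbolic graphs and their boundaries -/

section Hyperbolic

variable {V : Type*}

/-- The Gromov product `|x ∧ y| = (|x| + |y| - d(x, y)) / 2` with respect to the root `o`,
where `d` is the graph distance and `|x| = d(o, x)`. -/
noncomputable def gromovProduct (G : SimpleGraph V) (o x y : V) : ℝ :=
  ((G.dist o x : ℝ) + (G.dist o y : ℝ) - (G.dist x y : ℝ)) / 2

/-- `δ > 0` is a hyperbolicity constant of `G` with respect to `o`. -/
def IsHyperbolicConst (G : SimpleGraph V) (o : V) (δ : ℝ) : Prop :=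
  0 < δ ∧ ∀ x y z : V,
    min (gromovProduct G o x z) (gromovProduct G o z y) - δ ≤ gromovProduct G o x y

/-- A connected graph is hyperbolic if it has a hyperbolicity constant. -/
def IsHyperbolicGraph (G : SimpleGraph V) (o : V) : Prop :=
  G.Connected ∧ ∃ δ : ℝ, IsHyperbolicConst G o δ

open Classical in
/-- The hyperbolic metric `ρ_a`. -/
noncomputable def rho (G : SimpleGraph V) (o : V) (a : ℝ) (x y : V) : ℝ :=
  if x = y then 0 else Real.exp (-a * gromovProduct G o x y)

/-- The standing requirement on the parameter `a` of `ρ_a`: `a > 0` and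
`exp (δ a) - 1 < √2 - 1`, where `δ` is a hyperbolicity constant. -/
structure AdmissibleParam (G : SimpleGraph V) (o : V) (δ a : ℝ) : Prop where
  hyp : IsHyperbolicConst G o δ
  pos : 0 < a
  small : Real.exp (δ * a) - 1 < √2 - 1

theorem gromovProduct_comm (G : SimpleGraph V) (o x y : V) :
    gromovProduct G o x y = gromovProduct G o y x := by
  unfold gromovProduct
  rw [SimpleGraph.dist_comm (u := x) (v := y)]
  ring

theorem rho_self (G : SimpleGraph V) (o : V) (a : ℝ) (x : V) : rho G o a x x = 0 := by
  simp [rho]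

theorem rho_comm (G : SimpleGraph V) (o : V) (a : ℝ) (x y : V) :
    rho G o a x y = rho G o a y x := by
  by_cases h : x = y
  · rw [h]
  · simp only [rho, h, Ne.symm h, if_false, gromovProduct_comm G o x y]

theorem rho_nonneg (G : SimpleGraph V) (o : V) (a : ℝ) (x y : V) : 0 ≤ rho G o a x y := by
  unfold rho
  split_ifs
  · exact le_rfl
  · exact (Real.exp_pos _).le

theorem AdmissibleParam.rho_le {G : SimpleGraph V} {o : V} {δ a : ℝ}
    (h : AdmissibleParam G o δ a) (x y z : V) :
    rho G o a x y ≤ Real.exp (δ * a) * max (rho G o a x z) (rho G o a z y) := by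
  have h1 : (1 : ℝ) ≤ Real.exp (δ * a) := Real.one_le_exp (mul_pos h.hyp.1 h.pos).le
  have hxz := rho_nonneg G o a x z
  have hzy := rho_nonneg G o a z y
  by_cases hxy : x = y
  · subst hxy
    rw [rho_self]
    positivity
  by_cases e1 : x = z
  · subst e1
    rw [rho_self, max_eq_right hzy]
    nlinarith
  by_cases e2 : z = y
  · subst e2
    rw [rho_self, max_eq_left hxz]
    nlinarith
  have hh := h.hyp.2 x y z
  have ha := h.pos
  simp only [rho, hxy, e1, e2, if_false]
  rcases le_total (gromovProduct G o x z) (gromovProduct G o z y) with hle | hle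
  · rw [min_eq_left hle] at hh
    calc Real.exp (-a * gromovProduct G o x y)
        ≤ Real.exp (δ * a + -a * gromovProduct G o x z) := by
          apply Real.exp_le_exp.2
          nlinarith
      _ = Real.exp (δ * a) * Real.exp (-a * gromovProduct G o x z) := Real.exp_add _ _
      _ ≤ _ := by gcongr; exact le_max_left _ _
  · rw [min_eq_right hle] at hh
    calc Real.exp (-a * gromovProduct G o x y)
        ≤ Real.exp (δ * a + -a * gromovProduct G o z y) := by
          apply Real.exp_le_exp.2
          nlinarith
      _ = Real.exp (δ * a) * Real.exp (-a * gromovProduct G o z y) := Real.exp_add _ _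
      _ ≤ _ := by gcongr; exact le_max_right _ _

theorem rho_uniformity_basis (G : SimpleGraph V) (o : V) (a : ℝ) :
    (⨅ ε : {ε : ℝ // 0 < ε}, 𝓟 {p : V × V | rho G o a p.1 p.2 < ε}).HasBasis
      (fun ε : ℝ => 0 < ε) (fun ε => {p : V × V | rho G o a p.1 p.2 < ε}) := by
  have : Nonempty {ε : ℝ // 0 < ε} := ⟨⟨1, one_pos⟩⟩
  refine ⟨fun t => ?_⟩
  rw [mem_iInf_of_directed]
  · simp [mem_principal]
  · intro x y
    refine ⟨⟨min x.1 y.1, lt_min x.2 y.2⟩, ?_, ?_⟩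
    · exact principal_mono.2 fun p hp =>
        mem_ofPred_eq.mpr <| lt_of_lt_of_le (mem_ofPred_eq.mp hp) (min_le_left _ _)
    · exact principal_mono.2 fun p hp =>
        mem_ofPred_eq.mpr <| lt_of_lt_of_le (mem_ofPred_eq.mp hp) (min_le_right _ _)

/-- The uniform structure of `ρ_a`: its entourages are the sets containing some
`{(x, y) | ρ_a(x, y) < ε}`, `ε > 0`. -/
@[reducible]
noncomputable def rhoUniformSpace {G : SimpleGraph V} {o : V} {δ a : ℝ}
    (h : AdmissibleParam G o δ a) : UniformSpace V :=
  UniformSpace.ofCore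
    { uniformity := ⨅ ε : {ε : ℝ // 0 < ε}, 𝓟 {p : V × V | rho G o a p.1 p.2 < ε}
      refl := by
        refine le_iInf fun ε => principal_mono.2 ?_
        rintro ⟨x, y⟩ hp
        obtain rfl : x = y := by simpa using hp
        rw [mem_ofPred_eq, rho_self]
        exact ε.2
      symm := by
        refine tendsto_iInf.2 fun ε => tendsto_principal.2 ?_
        refine mem_iInf_of_mem ε (mem_principal.2 fun p hp => ?_)
        rw [mem_ofPred_eq, mem_ofPred_eq, Prod.fst_swap, Prod.snd_swap, rho_comm]
        exact hp
      comp := by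
        intro s hs
        obtain ⟨ε, hε, hsub⟩ := (rho_uniformity_basis G o a).mem_iff.1 hs
        have hE := Real.exp_pos (δ * a)
        refine (mem_lift'_sets (monotone_id.relComp monotone_id)).2
          ⟨{p : V × V | rho G o a p.1 p.2 < ε / Real.exp (δ * a)},
            (rho_uniformity_basis G o a).mem_of_mem (div_pos hε hE), ?_⟩
        rintro ⟨x, y⟩ ⟨z, hxz, hzy⟩
        refine hsub (lt_of_le_of_lt (h.rho_le x y z) ?_)
        have := max_lt (mem_ofPred_eq.mp hxz) (mem_ofPred_eq.mp hzy)
        dsimp only at this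
        rw [lt_div_iff₀ hE] at this
        rw [mul_comm]
        exact this }

/-- The vertex set of `G`, regarded as a space with the hyperbolic metric `ρ_a`. -/
def RhoSpace {G : SimpleGraph V} {o : V} {δ a : ℝ} (_h : AdmissibleParam G o δ a) : Type _ := V

noncomputable instance RhoSpace.instUniformSpace {G : SimpleGraph V} {o : V} {δ a : ℝ}
    (h : AdmissibleParam G o δ a) : UniformSpace (RhoSpace h) :=
  rhoUniformSpace h

/-- The completion `X̂` of `X` under `ρ_a`. -/
abbrev HypCompletion {G : SimpleGraph V} {o : V} {δ a : ℝ} (h : AdmissibleParam G o δ a) :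
    Type _ :=
  UniformSpace.Completion (RhoSpace h)

/-- The canonical map `X → X̂`. -/
noncomputable def toHypCompletion {G : SimpleGraph V} {o : V} {δ a : ℝ}
    (h : AdmissibleParam G o δ a) (x : V) : HypCompletion h :=
  ((↑) : RhoSpace h → UniformSpace.Completion (RhoSpace h)) x

/-- The hyperbolic boundary `∂X = X̂ \ X`. It carries the topology induced by `X̂`. -/
def HypBoundary {G : SimpleGraph V} {o : V} {δ a : ℝ} (h : AdmissibleParam G o δ a) :
    Set (HypCompletion h) :=
  (range (toHypCompletion h))ᶜ

/-- The extension of `ρ_a` to the completion: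
`ρ_a(ξ, η) = limsup ρ_a(x, y)` as `x → ξ`, `y → η` with `x, y ∈ X`. For distinct boundary
points this is `exp (-a |ξ ∧ η|)` with `|ξ ∧ η| = liminf |x ∧ y|`. -/
noncomputable def rhoExt {G : SimpleGraph V} {o : V} {δ a : ℝ} (h : AdmissibleParam G o δ a)
    (ξ η : HypCompletion h) : ℝ :=
  limsup (fun p : V × V => rho G o a p.1 p.2)
    (comap (toHypCompletion h) (𝓝 ξ) ×ˢ comap (toHypCompletion h) (𝓝 η))

end Hyperbolic

/-! ### Moran sets -/

/-- The set `D_k` of words of length `k`. Sequences are indexed from `0`: `n j` is the number of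
letters allowed in position `j + 1`. -/
abbrev MoranWord (n : ℕ → ℕ) (k : ℕ) : Type := (j : Fin k) → Fin (n j)

/-- The word `w i`, obtained by appending the letter `i`. -/
def MoranWord.append {n : ℕ → ℕ} {k : ℕ} (w : MoranWord n k) (i : Fin (n k)) :
    MoranWord n (k + 1) :=
  Fin.snoc (α := fun j : Fin (k + 1) => Fin (n j)) w i

/-- The family of basic sets `J w`, `w ∈ D`, has the Moran structure determined by `J₀`, the
numbers `n` and the ratios `rat`. -/
structure IsMoranStructure {d : ℕ} (J₀ : Set (EuclideanSpace ℝ (Fin d))) (n : ℕ → ℕ)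
    (rat : ℕ → ℝ) (J : (k : ℕ) → MoranWord n k → Set (EuclideanSpace ℝ (Fin d))) : Prop where
  root : ∀ w : MoranWord n 0, J 0 w = J₀
  similar : ∀ (k : ℕ) (w : MoranWord n k),
    ∃ S : EuclideanSpace ℝ (Fin d) →ᵈ EuclideanSpace ℝ (Fin d), J k w = S '' J₀
  subset : ∀ (k : ℕ) (w : MoranWord n k) (i : Fin (n k)), J (k + 1) (w.append i) ⊆ J k w
  disjoint : ∀ (k : ℕ) (w : MoranWord n k) (i j : Fin (n k)), i ≠ j →
    Disjoint (interior (J (k + 1) (w.append i))) (interior (J (k + 1) (w.append j)))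
  ratio : ∀ (k : ℕ) (w : MoranWord n k) (i : Fin (n k)),
    Metric.diam (J (k + 1) (w.append i)) / Metric.diam (J k w) = rat k

/-- The Moran set `E = ⋂ k, ⋃ w ∈ D_k, J w`. -/
def moranSet {d : ℕ} {n : ℕ → ℕ}
    (J : (k : ℕ) → MoranWord n k → Set (EuclideanSpace ℝ (Fin d))) :
    Set (EuclideanSpace ℝ (Fin d)) :=
  ⋂ k : ℕ, ⋃ w : MoranWord n k, J k w

/-- The number `r = inf_k r_k`. -/
noncomputable def ratInf (rat : ℕ → ℝ) : ℝ := ⨅ k, rat k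

/-- The product `r_1 ⋯ r_k` of the first `k` ratios. -/
noncomputable def ratProd (rat : ℕ → ℝ) (k : ℕ) : ℝ := ∏ j ∈ Finset.range k, rat j

/-- The level `X_N`: the words of length `k` with `r_1 ⋯ r_k ≤ r ^ N < r_1 ⋯ r_{k-1}`. For the
empty word the second inequality is void, so that `X_0` consists of the empty word. -/
def moranLevel (n : ℕ → ℕ) (rat : ℕ → ℝ) (N : ℕ) : Set (Σ k, MoranWord n k) :=
  {w | ratProd rat w.1 ≤ ratInf rat ^ N ∧ (0 < w.1 → ratInf rat ^ N < ratProd rat (w.1 - 1))}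

/-- The vertex set `X = ⋃ N, X_N`. -/
def MoranVertex (n : ℕ → ℕ) (rat : ℕ → ℝ) : Type :=
  {w : Σ k, MoranWord n k // ∃ N, w ∈ moranLevel n rat N}

/-- The root of the tree, that is, the empty word. -/
def moranRoot (n : ℕ → ℕ) (rat : ℕ → ℝ) : MoranVertex n rat :=
  ⟨⟨0, fun j => j.elim0⟩, 0, by simp [moranLevel, ratProd]⟩

/-- `u` is a prefix of `v`, that is, `v = u k` for some word `k`. -/
def IsWordPrefix {n : ℕ → ℕ} (u v : Σ k, MoranWord n k) : Prop :=
  ∃ h : u.1 ≤ v.1, ∀ j : Fin u.1, v.2 (Fin.castLE h j) = u.2 j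

/-- Vertical edges: `u = v⁻¹` is the first ancestor of `v`. -/
def MoranVertical {n : ℕ → ℕ} {rat : ℕ → ℝ} (u v : MoranVertex n rat) : Prop :=
  ∃ N : ℕ, u.1 ∈ moranLevel n rat N ∧ v.1 ∈ moranLevel n rat (N + 1) ∧ IsWordPrefix u.1 v.1

/-- Horizontal edges: distinct words of one level `X_N`, `N > 0`, whose basic sets meet. -/
def MoranHorizontal {d : ℕ} {n : ℕ → ℕ} {rat : ℕ → ℝ}
    (J : (k : ℕ) → MoranWord n k → Set (EuclideanSpace ℝ (Fin d)))
    (u v : MoranVertex n rat) : Prop :=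
  u ≠ v ∧ ∃ N : ℕ, 0 < N ∧ u.1 ∈ moranLevel n rat N ∧ v.1 ∈ moranLevel n rat N ∧
    (J u.1.1 u.1.2 ∩ J v.1.1 v.1.2).Nonempty

/-- The augmented tree `(X, ℰ_v ∪ ℰ_h)`; `SimpleGraph.fromRel` symmetrizes the relation. -/
def augmentedTree {d : ℕ} {n : ℕ → ℕ} (rat : ℕ → ℝ)
    (J : (k : ℕ) → MoranWord n k → Set (EuclideanSpace ℝ (Fin d))) :
    SimpleGraph (MoranVertex n rat) :=
  SimpleGraph.fromRel fun u v => MoranVertical u v ∨ MoranHorizontal J u v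

/-- Condition (H): there is `C' > 0` such that for all `N ≥ 1` and `u, v ∈ X_N`, either `J u`
meets `J v` or `dist (J u, J v) ≥ C' r ^ N`. -/
def ConditionH {d : ℕ} {n : ℕ → ℕ} (rat : ℕ → ℝ)
    (J : (k : ℕ) → MoranWord n k → Set (EuclideanSpace ℝ (Fin d))) : Prop :=
  ∃ C' : ℝ, 0 < C' ∧ ∀ N : ℕ, 1 ≤ N → ∀ u ∈ moranLevel n rat N, ∀ v ∈ moranLevel n rat N,
    (J u.1 u.2 ∩ J v.1 v.2).Nonempty ∨
      ∀ x ∈ J u.1 u.2, ∀ y ∈ J v.1 v.2, C' * ratInf rat ^ N ≤ dist x y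

/-! ### Trees of cells -/

/-! Only a few features of the Moran structure matter: closed nested cells, finitely many per level,
diameters at most `D * r ^ N`, and a uniform bound `K` on the cells of level `N` near a point.
`CellTree` records these, and the argument is carried out there.

Any walk can be replaced, without lengthening it, by one that goes up, then across a horizontal
chain, then down (`exists_chain_of_walk`). If the chain has `H` edges, then some `H / 2 + C` levels
higher its extent is at most one cell scale, so by packing it shrinks to at most `K` edges
(`Chain.shrink`). Hence, up to an additive constant, the Gromov product is the deepest level at
which the two ancestors are joined by at most `K` horizontal edges (`exists_chain_const`,
`gromovProduct_ge`). Concatenating two such chains gives hyperbolicity.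

The same description bounds the distance between points chosen in two cells by a multiple of `r ^ |x
∧ y| = ρ_a(x, y) ^ α`. The choice of points is therefore uniformly continuous and extends to the
completion. Boundary points are approached only through arbitrarily high levels, so they map into
the limit set; vertices whose cells contain `z` form a Cauchy sequence over `z`. The inverse is
continuous because, near `z`, only cells containing `z` occur at a given level, and these meet one
another. Condition (H) makes this quantitative: limit points closer than `C' * r ^ N` force the
cells of level `N` to meet.

For Moran sets, each level consists of the words of one length, and packing is a volume count of
disjoint balls inside the cells. -/

/-- A rooted tree `V` of subsets of a metric space `X`, with `G` the associated augmented tree: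
`lev` is the level of a vertex, `anc N v` the ancestor of `v` at level `N`. The cells of level `N`
have diameter at most `D * r ^ N`, and at most `K` of them meet any ball of that radius. -/
structure CellTree {V : Type*} (G : SimpleGraph V) (o : V) (X : Type*) [MetricSpace X] where
  lev : V → ℕ
  anc : ℕ → V → V
  cell : V → Set X
  r : ℝ
  D : ℝ
  K : ℕ
  r_pos : 0 < r
  r_lt_one : r < 1
  lev_eq_zero : ∀ v, lev v = 0 ↔ v = o
  lev_anc : ∀ {N v}, N ≤ lev v → lev (anc N v) = N
  anc_lev : ∀ v, anc (lev v) v = v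
  anc_anc : ∀ {N M v}, N ≤ M → M ≤ lev v → anc N (anc M v) = anc N v
  cell_subset : ∀ {N v}, N ≤ lev v → cell v ⊆ cell (anc N v)
  cell_nonempty : ∀ v, (cell v).Nonempty
  cell_closed : ∀ v, IsClosed (cell v)
  finite_level : ∀ N, {v | lev v = N}.Finite
  adj_iff : ∀ u v, G.Adj u v ↔ (lev v = lev u + 1 ∧ anc (lev u) v = u) ∨
    (lev u = lev v + 1 ∧ anc (lev v) u = v) ∨
    (u ≠ v ∧ lev u = lev v ∧ (cell u ∩ cell v).Nonempty)
  dist_le : ∀ v, ∀ x ∈ cell v, ∀ y ∈ cell v, dist x y ≤ D * r ^ lev v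
  packing : ∀ (N : ℕ) (p : X) (s : Finset V),
    (∀ v ∈ s, lev v = N ∧ ∃ x ∈ cell v, dist p x ≤ D * r ^ N) → s.card ≤ K

/-! ### Horizontal chains and their projection to ancestors. -/

namespace CellTree

variable {V : Type*} {G : SimpleGraph V} {o : V} {X : Type*} [MetricSpace X]
  (T : CellTree G o X)

/-- The graph of horizontal edges. -/
def horizontal : SimpleGraph V where
  Adj u v := u ≠ v ∧ T.lev u = T.lev v ∧ (T.cell u ∩ T.cell v).Nonempty
  symm := ⟨fun u v h => ⟨h.1.symm, h.2.1.symm, by rw [inter_comm]; exact h.2.2⟩⟩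
  loopless := ⟨fun u h => h.1 rfl⟩

theorem horizontal_le : T.horizontal ≤ G := fun u v h => (T.adj_iff u v).2 (Or.inr (Or.inr h))

theorem D_nonneg : 0 ≤ T.D := by
  obtain ⟨x, hx⟩ := T.cell_nonempty o
  have h := T.dist_le o x hx x hx
  rw [(T.lev_eq_zero o).2 rfl] at h
  simpa using h

/-- `u` and `v` are joined by a horizontal walk with at most `H` edges. -/
def Chain (H : ℕ) (u v : V) : Prop := ∃ w : T.horizontal.Walk u v, w.length ≤ H

variable {T}

theorem lev_eq_of_walk {u v : V} (w : T.horizontal.Walk u v) : T.lev u = T.lev v := by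
  induction w with
  | nil => rfl
  | cons h _ ih => exact h.2.1.trans ih

theorem Chain.refl (H : ℕ) (u : V) : T.Chain H u u := ⟨.nil, Nat.zero_le _⟩

theorem Chain.trans {H H' : ℕ} {u v x : V} (h : T.Chain H u v) (h' : T.Chain H' v x) :
    T.Chain (H + H') u x := by
  obtain ⟨w, hw⟩ := h
  obtain ⟨w', hw'⟩ := h'
  exact ⟨w.append w', by rw [SimpleGraph.Walk.length_append]; omega⟩

theorem chain_one_of_inter {u v : V} (hl : T.lev u = T.lev v)
    (h : (T.cell u ∩ T.cell v).Nonempty) : T.Chain 1 u v := by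
  by_cases huv : u = v
  · subst huv
    exact Chain.refl 1 u
  · exact ⟨.cons (show T.horizontal.Adj u v from ⟨huv, hl, h⟩) .nil, le_rfl⟩

theorem inter_anc {u v : V} (hl : T.lev u = T.lev v) (h : (T.cell u ∩ T.cell v).Nonempty)
    {N : ℕ} (hN : N ≤ T.lev u) : (T.cell (T.anc N u) ∩ T.cell (T.anc N v)).Nonempty :=
  h.mono (inter_subset_inter (T.cell_subset hN) (T.cell_subset (hl ▸ hN)))

/-- Cells grow on passing to ancestors, so each edge projects to an edge or collapses to a vertex.
The clause on supports lets `Chain.shrink` locate every vertex of the projected walk. -/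
theorem exists_walk_anc {u v : V} (w : T.horizontal.Walk u v) {N : ℕ} (hN : N ≤ T.lev u) :
    ∃ w' : T.horizontal.Walk (T.anc N u) (T.anc N v), w'.length ≤ w.length ∧
      ∀ z' ∈ w'.support, ∃ z ∈ w.support, T.anc N z = z' := by
  induction w with
  | nil => exact ⟨.nil, le_rfl, by simp⟩
  | @cons u v x h w ih =>
    obtain ⟨w', hw', hs⟩ := ih (h.2.1 ▸ hN)
    by_cases huv : T.anc N u = T.anc N v
    · rw [huv]
      refine ⟨w', hw'.trans (by simp), fun z' hz' => ?_⟩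
      obtain ⟨z, hz, rfl⟩ := hs z' hz'
      exact ⟨z, by simp [hz], rfl⟩
    · refine ⟨.cons (show T.horizontal.Adj _ _ from ⟨huv, ?_, inter_anc h.2.1 h.2.2 hN⟩) w',
        by simpa using hw', ?_⟩
      · rw [T.lev_anc hN, T.lev_anc (h.2.1 ▸ hN)]
      · intro z' hz'
        rw [SimpleGraph.Walk.support_cons, List.mem_cons] at hz'
        rcases hz' with rfl | hz'
        · exact ⟨u, by simp, rfl⟩
        · obtain ⟨z, hz, rfl⟩ := hs z' hz'
          exact ⟨z, by simp [hz], rfl⟩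

theorem Chain.anc {H : ℕ} {u v : V} (h : T.Chain H u v) {N : ℕ} (hN : N ≤ T.lev u) :
    T.Chain H (T.anc N u) (T.anc N v) := by
  obtain ⟨w, hw⟩ := h
  obtain ⟨w', hw', -⟩ := exists_walk_anc w hN
  exact ⟨w', hw'.trans hw⟩

/-- Consecutive cells share a point, and a walk with `L` edges visits `L + 1` cells of the same
scale. -/
theorem dist_le_of_walk {u v : V} (w : T.horizontal.Walk u v) {x y : X} (hx : x ∈ T.cell u)
    (hy : y ∈ T.cell v) : dist x y ≤ (w.length + 1) * (T.D * T.r ^ T.lev u) := by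
  induction w generalizing x with
  | nil => simpa using T.dist_le _ _ hx _ hy
  | @cons u v z h w ih =>
    obtain ⟨q, hq, hq'⟩ := h.2.2
    have h1 := T.dist_le _ _ hx _ hq
    have h2 := ih hq' hy
    rw [← h.2.1] at h2
    have := dist_triangle x q y
    rw [SimpleGraph.Walk.length_cons]
    push_cast
    linarith

theorem Chain.dist_le {H : ℕ} {u v : V} (h : T.Chain H u v) {x y : X} (hx : x ∈ T.cell u)
    (hy : y ∈ T.cell v) : dist x y ≤ (H + 1) * (T.D * T.r ^ T.lev u) := by
  obtain ⟨w, hw⟩ := h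
  refine (dist_le_of_walk w hx hy).trans ?_
  have := T.D_nonneg
  have := T.r_pos
  gcongr

/-- Going up `t` levels turns a horizontal chain with at most `r ^ (-t) - 1` edges into one whose
length is bounded by the packing constant. -/
theorem Chain.shrink {H : ℕ} {u v : V} (h : T.Chain H u v) {N : ℕ} (hN : N ≤ T.lev u)
    (hH : (H + 1) * T.r ^ (T.lev u - N) ≤ 1) : T.Chain T.K (T.anc N u) (T.anc N v) := by
  classical
  obtain ⟨w, hw⟩ := h
  obtain ⟨w', -, hs⟩ := exists_walk_anc w hN
  -- Removing repetitions makes the vertices distinct, so packing bounds their number, which is the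
  -- length plus one.
  refine ⟨w'.bypass, ?_⟩
  obtain ⟨p, hp⟩ := T.cell_nonempty u
  have hD := T.D_nonneg
  have hr := T.r_pos
  have key := T.packing N p w'.bypass.support.toFinset ?_
  · rw [List.toFinset_card_of_nodup (w'.bypass_isPath).support_nodup,
      SimpleGraph.Walk.length_support] at key
    omega
  · intro z' hz'
    rw [List.mem_toFinset] at hz'
    obtain ⟨z, hz, rfl⟩ := hs z' (w'.support_bypass_subset_support hz')
    have hl := lev_eq_of_walk (w.takeUntil z hz)
    refine ⟨T.lev_anc (hl ▸ hN), ?_⟩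
    obtain ⟨q, hq⟩ := T.cell_nonempty z
    refine ⟨q, T.cell_subset (hl ▸ hN) hq, ?_⟩
    have h1 := dist_le_of_walk (w.takeUntil z hz) hp hq
    have h2 : ((w.takeUntil z hz).length : ℝ) ≤ H := by
      exact_mod_cast (w.length_takeUntil_le_length hz).trans hw
    calc dist p q ≤ (H + 1) * (T.D * T.r ^ T.lev u) := by
          refine h1.trans ?_
          gcongr
      _ = ((H + 1) * T.r ^ (T.lev u - N)) * (T.D * T.r ^ N) := by
          conv_lhs => rw [← Nat.sub_add_cancel hN, pow_add]
          ring
      _ ≤ 1 * (T.D * T.r ^ N) := by gcongr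
      _ = _ := one_mul _

/-! #### Levels and the graph distance -/

theorem exists_walk_from_anc {N : ℕ} (v : V) (hN : N ≤ T.lev v) :
    ∃ w : G.Walk (T.anc N v) v, w.length + N = T.lev v := by
  obtain ⟨m, hm⟩ := Nat.exists_eq_add_of_le hN
  induction m generalizing N with
  | zero =>
    have : T.anc N v = v := by rw [show N = T.lev v by omega, T.anc_lev]
    rw [this]
    exact ⟨.nil, by simp [hm]⟩
  | succ m ih =>
    obtain ⟨w, hw⟩ := ih (N := N + 1) (by omega) (by omega)
    have h1 := T.lev_anc hN
    have h2 := T.lev_anc (show N + 1 ≤ T.lev v by omega)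
    have hadj : G.Adj (T.anc N v) (T.anc (N + 1) v) := by
      refine (T.adj_iff _ _).2 (Or.inl ⟨by rw [h1, h2], ?_⟩)
      rw [h1, T.anc_anc (Nat.le_succ N) (by omega)]
    exact ⟨.cons hadj w, by rw [SimpleGraph.Walk.length_cons]; omega⟩

theorem anc_zero (v : V) : T.anc 0 v = o :=
  (T.lev_eq_zero _).1 (T.lev_anc (Nat.zero_le _))

theorem connected (T : CellTree G o X) : G.Connected := by
  have h : ∀ v, G.Reachable o v := fun v => by
    obtain ⟨w, -⟩ := exists_walk_from_anc (T := T) v (Nat.zero_le _)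
    exact ⟨w.copy (anc_zero v) rfl⟩
  exact { preconnected := fun u v => (h u).symm.trans (h v), nonempty := ⟨o⟩ }

theorem lev_le_of_walk {u v : V} (w : G.Walk u v) : T.lev v ≤ T.lev u + w.length := by
  induction w with
  | nil => simp
  | @cons u v x h w ih =>
    rw [SimpleGraph.Walk.length_cons]
    rcases (T.adj_iff _ _).1 h with h | h | h
    · omega
    · omega
    · have := h.2.1
      omega

variable (T) in
theorem dist_root (v : V) : G.dist o v = T.lev v := by
  apply le_antisymm
  · obtain ⟨w, hw⟩ := exists_walk_from_anc (T := T) v (Nat.zero_le _)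
    have := G.dist_le (w.copy (anc_zero v) rfl)
    rwa [SimpleGraph.Walk.length_copy, ← Nat.add_zero w.length, hw] at this
  · obtain ⟨w, hw⟩ := T.connected.exists_walk_length_eq_dist o v
    have := lev_le_of_walk (T := T) w
    rwa [(T.lev_eq_zero o).2 rfl, zero_add, hw] at this

/-! ### Gromov products, horizontal chains and hyperbolicity. -/

variable (T) in
theorem gromovProduct_eq (x y : V) :
    gromovProduct G o x y = ((T.lev x : ℝ) + T.lev y - G.dist x y) / 2 := by
  rw [gromovProduct, T.dist_root, T.dist_root]

variable (T) in
theorem gromovProduct_le_lev (x y : V) : gromovProduct G o x y ≤ T.lev x := by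
  obtain ⟨w, hw⟩ := T.connected.exists_walk_length_eq_dist x y
  have h : (T.lev y : ℝ) ≤ T.lev x + G.dist x y := by
    exact_mod_cast hw ▸ lev_le_of_walk (T := T) w
  rw [T.gromovProduct_eq]
  linarith

theorem gromovProduct_ge {H N : ℕ} {x y : V} (hx : N ≤ T.lev x) (hy : N ≤ T.lev y)
    (h : T.Chain H (T.anc N x) (T.anc N y)) : (N : ℝ) - H / 2 ≤ gromovProduct G o x y := by
  obtain ⟨w, hw⟩ := h
  obtain ⟨wx, hwx⟩ := exists_walk_from_anc x hx
  obtain ⟨wy, hwy⟩ := exists_walk_from_anc y hy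
  have h1 := G.dist_le (wx.reverse.append ((w.mapLe T.horizontal_le).append wy))
  simp only [SimpleGraph.Walk.length_append, SimpleGraph.Walk.length_reverse,
    SimpleGraph.Walk.length_map, SimpleGraph.Walk.mapLe] at h1
  have h2 : (G.dist x y : ℝ) + 2 * N ≤ T.lev x + T.lev y + H := by
    exact_mod_cast (show G.dist x y + 2 * N ≤ T.lev x + T.lev y + H by omega)
  rw [T.gromovProduct_eq]
  linarith

theorem gromovProduct_nonneg (T : CellTree G o X) (x y : V) : 0 ≤ gromovProduct G o x y := by
  have := gromovProduct_ge (T := T) (H := 0) (N := 0) (x := x) (y := y) (Nat.zero_le _)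
    (Nat.zero_le _) (by rw [anc_zero, anc_zero]; exact Chain.refl 0 o)
  simpa using this

/-- Induction on the walk, prepending one edge: a vertical edge keeps the chain or projects it one
level up, and a horizontal edge projects to level `N` and lengthens the chain by at most one. For a
geodesic the inequality says that the Gromov product is at most `N - H / 2`. -/
theorem exists_chain_of_walk {x y : V} (w : G.Walk x y) :
    ∃ N H : ℕ, N ≤ T.lev x ∧ N ≤ T.lev y ∧ T.Chain H (T.anc N x) (T.anc N y) ∧
      T.lev x + T.lev y + H ≤ w.length + 2 * N := by
  induction w with
  | @nil u => exact ⟨T.lev u, 0, le_rfl, le_rfl, Chain.refl _ _, by simp; omega⟩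
  | @cons x x' y h w ih =>
    obtain ⟨N, H, hx, hy, hc, hl⟩ := ih
    rw [SimpleGraph.Walk.length_cons]
    rcases (T.adj_iff _ _).1 h with ⟨h1, h2⟩ | ⟨h1, h2⟩ | ⟨-, h1, h2⟩
    · rcases Nat.lt_or_ge (T.lev x) N with hN | hN
      -- The chain sits at the level of the child `x'`, below `x`, and must be lifted. Then `2 * N`
      -- drops by two, which the extra edge and the passage from `lev x'` to `lev x` exactly
      -- balance.
      · obtain rfl : N = T.lev x + 1 := by omega
        refine ⟨T.lev x, H, le_rfl, by omega, ?_, by omega⟩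
        rw [T.anc_lev]
        have := hc.anc (N := T.lev x) (by rw [T.lev_anc hx]; omega)
        rwa [T.anc_anc (Nat.le_succ _) hx, T.anc_anc (Nat.le_succ _) hy, h2] at this
      · refine ⟨N, H, hN, hy, ?_, by omega⟩
        rwa [← h2, T.anc_anc hN (by omega)]
    · refine ⟨N, H, by omega, hy, ?_, by omega⟩
      rwa [← h2, T.anc_anc hx (by omega)] at hc
    · refine ⟨N, 1 + H, by omega, hy, ?_, by omega⟩
      refine (chain_one_of_inter ?_ (inter_anc h1 h2 (by omega))).trans hc
      rw [T.lev_anc (by omega), T.lev_anc hx]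

-- Exponential decay beats linear growth. The shift `H / 2` is what the bound `N - H / 2` on the
-- Gromov product makes available.
variable (T) in
theorem exists_shrink_const : ∃ C : ℕ, ∀ H : ℕ, ((H : ℝ) + 1) * T.r ^ (H / 2 + C) ≤ 1 := by
  have hr := T.r_pos
  have h1 : Tendsto (fun m : ℕ => (m : ℝ) * T.r ^ m) atTop (𝓝 0) :=
    tendsto_self_mul_const_pow_of_lt_one hr.le T.r_lt_one
  obtain ⟨B, hB⟩ := h1.bddAbove_range
  obtain ⟨C, hC⟩ := exists_pow_lt_of_lt_one (show 0 < 1 / (2 * |B| + 2) by positivity) T.r_lt_one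
  refine ⟨C, fun H => ?_⟩
  have h2 : ((H / 2 : ℕ) : ℝ) * T.r ^ (H / 2) ≤ |B| := (hB ⟨H / 2, rfl⟩).trans (le_abs_self B)
  have h3 : T.r ^ (H / 2) ≤ 1 := pow_le_one₀ hr.le T.r_lt_one.le
  have h4 : (H : ℝ) + 1 ≤ 2 * ((H / 2 : ℕ) : ℝ) + 2 := by
    exact_mod_cast (show H + 1 ≤ 2 * (H / 2) + 2 by omega)
  rw [lt_div_iff₀ (by positivity)] at hC
  calc ((H : ℝ) + 1) * T.r ^ (H / 2 + C)
      ≤ (2 * ((H / 2 : ℕ) : ℝ) + 2) * T.r ^ (H / 2 + C) := by gcongr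
    _ = (2 * (((H / 2 : ℕ) : ℝ) * T.r ^ (H / 2)) + 2 * T.r ^ (H / 2)) * T.r ^ C := by
        rw [pow_add]; ring
    _ ≤ (2 * |B| + 2 * 1) * T.r ^ C := by gcongr
    _ ≤ 1 := by linarith

variable (T) in
/-- The ancestors of `x` and `y` at a level a bounded amount below the Gromov product are joined
by a horizontal chain of bounded length. -/
theorem exists_chain_const : ∃ C : ℕ, ∀ (x y : V) (N : ℕ), (N : ℝ) + C ≤ gromovProduct G o x y →
    N ≤ T.lev x ∧ N ≤ T.lev y ∧ T.Chain T.K (T.anc N x) (T.anc N y) := by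
  obtain ⟨C, hC⟩ := T.exists_shrink_const
  refine ⟨C, fun x y N hN => ?_⟩
  obtain ⟨w, hw⟩ := T.connected.exists_walk_length_eq_dist x y
  obtain ⟨M, H, hx, hy, hc, hl⟩ := exists_chain_of_walk (T := T) w
  rw [hw] at hl
  have hl' : (T.lev x : ℝ) + T.lev y + H ≤ G.dist x y + 2 * M := by exact_mod_cast hl
  rw [T.gromovProduct_eq] at hN
  -- Level `N` thus lies at least `H / 2 + C` levels above the chain at level `M`.
  have h1 : 2 * N + 2 * C + H ≤ 2 * M := by
    have : (2 : ℝ) * N + 2 * C + H ≤ 2 * M := by linarith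
    exact_mod_cast this
  refine ⟨by omega, by omega, ?_⟩
  have := hc.shrink (N := N) (by rw [T.lev_anc hx]; omega) ?_
  · rwa [T.anc_anc (by omega) hx, T.anc_anc (by omega) hy] at this
  · rw [T.lev_anc hx]
    refine le_trans ?_ (hC H)
    have := T.r_pos
    gcongr ?_ * ?_
    exact pow_le_pow_of_le_one T.r_pos.le T.r_lt_one.le (by omega)

/-- At level `⌊g - C⌋` the chains from `x` to `z` and from `z` to `y` join into one with at most `2
* K` edges, which costs `K`; the floor costs `1`. When `g < C`, nonnegativity of the Gromov product
suffices. -/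
theorem isHyperbolicGraph (T : CellTree G o X) : IsHyperbolicGraph G o := by
  obtain ⟨C, hC⟩ := T.exists_chain_const
  refine ⟨T.connected, (C : ℝ) + 1 + T.K, by positivity, fun x y z => ?_⟩
  set g := min (gromovProduct G o x z) (gromovProduct G o z y)
  have h0 := T.gromovProduct_nonneg x y
  rcases lt_or_ge (g - C) 0 with hg | hg
  · have : (0 : ℝ) ≤ T.K := Nat.cast_nonneg _
    linarith
  · have h1 := Nat.floor_le hg
    have h2 := Nat.lt_floor_add_one (g - C)
    have h3 : g ≤ gromovProduct G o x z := min_le_left _ _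
    have h4 : g ≤ gromovProduct G o z y := min_le_right _ _
    obtain ⟨hx, -, hxz⟩ := hC x z ⌊g - C⌋₊ (by linarith)
    obtain ⟨-, hy, hzy⟩ := hC z y ⌊g - C⌋₊ (by linarith)
    have := gromovProduct_ge hx hy (hxz.trans hzy)
    push_cast at this
    linarith

end CellTree

/-! ### The boundary of a hyperbolic graph -/

section Boundary

open UniformSpace

variable {V : Type*} {G : SimpleGraph V} {o : V} {δ a : ℝ} (h : AdmissibleParam G o δ a)

/-- The trace on `V` of the neighbourhood filter of a point of the completion. -/
noncomputable def nhdsTrace (ξ : HypCompletion h) : Filter V := comap (toHypCompletion h) (𝓝 ξ)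

theorem uniformity_rhoSpace_basis :
    (uniformity (RhoSpace h)).HasBasis (fun ε : ℝ => 0 < ε)
      (fun ε => {p : V × V | rho G o a p.1 p.2 < ε}) :=
  rho_uniformity_basis G o a

theorem comap_uniformity_completion :
    comap (Prod.map (toHypCompletion h) (toHypCompletion h)) (uniformity (HypCompletion h)) =
      uniformity (RhoSpace h) :=
  (Completion.isUniformInducing_coe (RhoSpace h)).comap_uniformity

instance nhdsTrace_neBot (ξ : HypCompletion h) : (nhdsTrace h ξ).NeBot :=
  (Completion.isDenseInducing_coe (α := RhoSpace h)).comap_nhds_neBot ξ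

theorem tendsto_nhdsTrace (ξ : HypCompletion h) :
    Tendsto (toHypCompletion h) (nhdsTrace h ξ) (𝓝 ξ) := tendsto_comap

theorem eventually_rho_lt (ξ : HypCompletion h) {ε : ℝ} (hε : 0 < ε) :
    ∀ᶠ p in nhdsTrace h ξ ×ˢ nhdsTrace h ξ, rho G o a p.1 p.2 < ε := by
  have h1 : nhdsTrace h ξ ×ˢ nhdsTrace h ξ ≤
      comap (Prod.map (toHypCompletion h) (toHypCompletion h)) (uniformity (HypCompletion h)) :=
    map_le_iff_le_comap.1 <|
      ((tendsto_nhdsTrace h ξ).prodMap (tendsto_nhdsTrace h ξ)).trans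
        (nhds_prod_eq.symm.trans_le (nhds_le_uniformity ξ))
  rw [comap_uniformity_completion] at h1
  exact h1 ((uniformity_rhoSpace_basis h).mem_of_mem hε)

/-- Points of the completion whose traces are close for `ρ_a` are close. -/
theorem exists_rho_lt_of_mem_uniformity {U : Set (HypCompletion h × HypCompletion h)}
    (hU : U ∈ uniformity (HypCompletion h)) :
    ∃ ε : ℝ, 0 < ε ∧ ∀ ξ η : HypCompletion h,
      (∀ᶠ p in nhdsTrace h ξ ×ˢ nhdsTrace h η, rho G o a p.1 p.2 < ε) → (ξ, η) ∈ U := by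
  -- A closed entourage allows passing to the limit from vertices to points of the completion.
  obtain ⟨W, ⟨hW, hWc⟩, hWU⟩ := uniformity_hasBasis_closed.mem_iff.1 hU
  have h1 : Prod.map (toHypCompletion h) (toHypCompletion h) ⁻¹' W ∈ uniformity (RhoSpace h) := by
    rw [← comap_uniformity_completion]
    exact preimage_mem_comap hW
  obtain ⟨ε, hε, hsub⟩ := (uniformity_rhoSpace_basis h).mem_iff.1 h1
  refine ⟨ε, hε, fun ξ η hp => hWU ?_⟩
  refine hWc.mem_of_tendsto (f := Prod.map (toHypCompletion h) (toHypCompletion h))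
    (b := nhdsTrace h ξ ×ˢ nhdsTrace h η) ?_ (hp.mono fun p hp => hsub hp)
  rw [nhds_prod_eq]
  exact (tendsto_nhdsTrace h ξ).prodMap (tendsto_nhdsTrace h η)

theorem rhoExt_le {ξ η : HypCompletion h} {c : ℝ}
    (hc : ∀ᶠ p in nhdsTrace h ξ ×ˢ nhdsTrace h η, rho G o a p.1 p.2 ≤ c) :
    rhoExt h ξ η ≤ c :=
  limsup_le_of_le (f := nhdsTrace h ξ ×ˢ nhdsTrace h η)
    (isCoboundedUnder_le_of_le _ fun p => rho_nonneg G o a p.1 p.2) hc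

theorem AdmissibleParam.rho_le_one (h : AdmissibleParam G o δ a)
    (hG : ∀ x y, 0 ≤ gromovProduct G o x y) (x y : V) :
    rho G o a x y ≤ 1 := by
  unfold rho
  split_ifs
  · exact zero_le_one
  · rw [Real.exp_le_one_iff]
    nlinarith [hG x y, h.pos]

end Boundary

/-! ### The limit map and its metric estimates. -/

namespace CellTree

open UniformSpace

variable {V : Type*} {G : SimpleGraph V} {o : V} {X : Type*} [MetricSpace X]
  (T : CellTree G o X) {δ a : ℝ} (h : AdmissibleParam G o δ a)

/-- The points lying in cells of all levels. -/
def limitSet : Set X := {z | ∀ N, ∃ v, T.lev v = N ∧ z ∈ T.cell v}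

/-- A point of the cell of `v`. -/
noncomputable def point (v : V) : X := (T.cell_nonempty v).some

theorem point_mem (v : V) : T.point v ∈ T.cell v := (T.cell_nonempty v).some_mem

theorem exponent_pos {a : ℝ} (ha : 0 < a) : 0 < -Real.log T.r / a :=
  div_pos (neg_pos.2 (Real.log_neg T.r_pos T.r_lt_one)) ha

theorem exp_rpow_exponent {a : ℝ} (ha : 0 < a) (g : ℝ) :
    Real.exp (-a * g) ^ (-Real.log T.r / a) = T.r ^ g := by
  rw [← Real.exp_mul, Real.rpow_def_of_pos T.r_pos]
  congr 1
  field_simp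

/-- Both points lie in cells of ancestors at level `N = ⌊g - C⌋` (or `0`) joined by at most `K`
edges, so their distance is at most `(K + 1) * D * r ^ N`. The factor `r ^ (-(C + 1))` converts `r ^
N` to `r ^ g`; the final `+ 1` only makes the constant positive. -/
theorem exists_dist_point_le (h : AdmissibleParam G o δ a) : ∃ C : ℝ, 0 < C ∧ ∀ x y,
    dist (T.point x) (T.point y) ≤ C * rho G o a x y ^ (-Real.log T.r / a) := by
  obtain ⟨C, hC⟩ := T.exists_chain_const
  have hr := T.r_pos
  have hD := T.D_nonneg
  refine ⟨(T.K + 1) * T.D * T.r ^ (-((C : ℝ) + 1)) + 1, by positivity, fun x y => ?_⟩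
  by_cases hxy : x = y
  · subst hxy
    have := rho_nonneg G o a x x
    rw [dist_self]
    positivity
  set g := gromovProduct G o x y with hg
  have hrho : rho G o a x y ^ (-Real.log T.r / a) = T.r ^ g := by
    rw [← T.exp_rpow_exponent h.pos, rho, if_neg hxy]
  rw [hrho]
  have key : ∀ N : ℕ, N ≤ T.lev x → N ≤ T.lev y → T.Chain T.K (T.anc N x) (T.anc N y) →
      g < N + C + 1 → dist (T.point x) (T.point y) ≤
        ((T.K + 1) * T.D * T.r ^ (-((C : ℝ) + 1)) + 1) * T.r ^ g := by
    intro N hx hy hc hgN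
    have h1 := hc.dist_le (T.cell_subset hx (T.point_mem x)) (T.cell_subset hy (T.point_mem y))
    rw [T.lev_anc hx] at h1
    have h2 : T.r ^ N ≤ T.r ^ (-((C : ℝ) + 1)) * T.r ^ g := by
      rw [← Real.rpow_add hr, ← Real.rpow_natCast]
      exact Real.rpow_le_rpow_of_exponent_ge hr T.r_lt_one.le (by linarith)
    calc dist (T.point x) (T.point y) ≤ (T.K + 1) * (T.D * T.r ^ N) := h1
      _ ≤ (T.K + 1) * (T.D * (T.r ^ (-((C : ℝ) + 1)) * T.r ^ g)) := by gcongr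
      _ ≤ _ := by
        have : 0 < T.r ^ g := Real.rpow_pos_of_pos hr _
        linarith
  rcases lt_or_ge (g - C) 0 with hlt | hge
  · refine key 0 (Nat.zero_le _) (Nat.zero_le _) ?_ (by push_cast; linarith)
    rw [anc_zero, anc_zero]
    exact Chain.refl _ _
  · have h1 := Nat.floor_le hge
    have h2 := Nat.lt_floor_add_one (g - C)
    obtain ⟨hx, hy, hc⟩ := hC x y ⌊g - C⌋₊ (by linarith)
    exact key _ hx hy hc (by linarith)

theorem rho_le_of_inter (ha : 0 < a) {N : ℕ} {x y : V} (hx : N ≤ T.lev x) (hy : N ≤ T.lev y)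
    (hi : (T.cell (T.anc N x) ∩ T.cell (T.anc N y)).Nonempty) :
    rho G o a x y ≤ Real.exp (-a * (N - 1 / 2)) := by
  have := gromovProduct_ge hx hy
    (chain_one_of_inter (by rw [T.lev_anc hx, T.lev_anc hy]) hi)
  unfold rho
  split_ifs
  · positivity
  · rw [Real.exp_le_exp]
    push_cast at this
    nlinarith

/-- Every vertex is isolated, at a scale depending only on its level. This is what separates the
vertices from the boundary. -/
theorem le_rho_of_ne (ha : 0 < a) {x y : V} (hxy : x ≠ y) :
    Real.exp (-a * T.lev x) ≤ rho G o a x y := by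
  rw [rho, if_neg hxy, Real.exp_le_exp]
  nlinarith [T.gromovProduct_le_lev x y]

theorem exists_exp_lt (ha : 0 < a) {ε : ℝ} (hε : 0 < ε) :
    ∃ N : ℕ, ∀ M ≥ N, Real.exp (-a * ((M : ℝ) - 1 / 2)) < ε := by
  have h1 : Tendsto (fun M : ℕ => Real.exp (-a * ((M : ℝ) - 1 / 2))) atTop (𝓝 0) := by
    refine Real.tendsto_exp_atBot.comp ?_
    refine Tendsto.const_mul_atTop_of_neg (by linarith) ?_
    exact tendsto_atTop_add_const_right _ _ tendsto_natCast_atTop_atTop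
  exact eventually_atTop.1 (h1.eventually_lt_const hε)

theorem uniformContinuous_point : @UniformContinuous (RhoSpace h) X _ _ T.point := by
  obtain ⟨C, hC, hp⟩ := T.exists_dist_point_le h
  have hα := T.exponent_pos h.pos
  refine ((uniformity_rhoSpace_basis h).uniformContinuous_iff Metric.uniformity_basis_dist).2
    fun ε hε => ⟨(ε / C) ^ (-Real.log T.r / a)⁻¹, by positivity, fun x y hxy => ?_⟩
  have hxy' : rho G o a x y < (ε / C) ^ (-Real.log T.r / a)⁻¹ := hxy
  refine (hp x y).trans_lt ?_
  rw [← lt_div_iff₀' hC]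
  calc rho G o a x y ^ (-Real.log T.r / a)
      < ((ε / C) ^ (-Real.log T.r / a)⁻¹) ^ (-Real.log T.r / a) :=
        Real.rpow_lt_rpow (rho_nonneg _ _ _ _ _) hxy' hα
    _ = ε / C := Real.rpow_inv_rpow (by positivity) hα.ne'

theorem eventually_rho_lt_of_rhoExt_lt (T : CellTree G o X) (h : AdmissibleParam G o δ a)
    {ξ η : HypCompletion h} {c : ℝ} (hc : rhoExt h ξ η < c) :
    ∀ᶠ p in nhdsTrace h ξ ×ˢ nhdsTrace h η, rho G o a p.1 p.2 < c :=
  eventually_lt_of_limsup_lt hc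
    (isBoundedUnder_of ⟨1, fun p => h.rho_le_one T.gromovProduct_nonneg p.1 p.2⟩)

theorem rhoExt_nonneg (T : CellTree G o X) (h : AdmissibleParam G o δ a) (ξ η : HypCompletion h) :
    0 ≤ rhoExt h ξ η := by
  by_contra! hlt
  obtain ⟨p, hp⟩ := (T.eventually_rho_lt_of_rhoExt_lt h hlt).exists
  exact absurd hp (not_lt.2 (rho_nonneg _ _ _ _ _))

/-- A point of the boundary is approached through vertices of arbitrarily high level. -/
theorem eventually_le_lev {ξ : HypCompletion h} (hξ : ξ ∈ HypBoundary h) (N : ℕ) :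
    ∀ᶠ x in nhdsTrace h ξ, N ≤ T.lev x := by
  by_contra hN
  -- A vertex of level below `N` has no other vertex within this radius. If one lay in `A`, then `A`
  -- would be a singleton and `ξ` would be that vertex.
  obtain ⟨A, hA, hAr⟩ := (eventually_prod_self_iff (r := fun x y => rho G o a x y < _)).1
    (eventually_rho_lt h ξ (Real.exp_pos (-a * N)))
  obtain ⟨x, hxN, hxA⟩ := ((not_eventually.1 hN).and_eventually hA).exists
  have hAx : ∀ y ∈ A, y = x := fun y hy => by
    by_contra hne
    have h1 := hAr x hxA y hy
    have h2 := T.le_rho_of_ne h.pos (Ne.symm hne)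
    have h3 : Real.exp (-a * N) ≤ Real.exp (-a * T.lev x) := by
      rw [Real.exp_le_exp]
      have : (T.lev x : ℝ) ≤ N := by exact_mod_cast (not_le.1 hxN).le
      nlinarith [h.pos]
    linarith
  have h1 : Tendsto (toHypCompletion h) (nhdsTrace h ξ) (𝓝 (toHypCompletion h x)) := by
    refine tendsto_nhds_of_eventually_eq ?_
    filter_upwards [hA] with y hy
    rw [hAx y hy]
  exact hξ ⟨x, tendsto_nhds_unique h1 (tendsto_nhdsTrace h ξ)⟩

/-- Take for `U` the complement of the finitely many closed cells of level `N` that miss `z`. -/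
theorem exists_nhds_mem_cell (z : X) (N : ℕ) :
    ∃ U ∈ 𝓝 z, IsOpen U ∧ ∀ v, T.lev v = N → ∀ y ∈ U, y ∈ T.cell v → z ∈ T.cell v := by
  have hfin : {v | T.lev v = N ∧ z ∉ T.cell v}.Finite :=
    (T.finite_level N).subset fun v hv => hv.1
  refine ⟨(⋃ v ∈ {v | T.lev v = N ∧ z ∉ T.cell v}, T.cell v)ᶜ, ?_, ?_, fun v hv y hy hyv => ?_⟩
  · refine (hfin.isClosed_biUnion fun v _ => T.cell_closed v).isOpen_compl.mem_nhds ?_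
    simp only [mem_compl_iff, mem_iUnion, not_exists]
    exact fun v hv hz => hv.2 hz
  · exact (hfin.isClosed_biUnion fun v _ => T.cell_closed v).isOpen_compl
  · by_contra hz
    exact hy (mem_biUnion (show v ∈ {v | T.lev v = N ∧ z ∉ T.cell v} from ⟨hv, hz⟩) hyv)

/-- The continuous extension of `T.point` to the completion. -/
noncomputable def limitMap : HypCompletion h → X :=
  Completion.extension (α := RhoSpace h) T.point

theorem limitMap_coe (x : V) : T.limitMap h (toHypCompletion h x) = T.point x :=
  Completion.extension_coe (T.uniformContinuous_point h) x

variable [CompleteSpace X]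

theorem continuous_limitMap : Continuous (T.limitMap h) := Completion.continuous_extension

theorem tendsto_point (ξ : HypCompletion h) :
    Tendsto T.point (nhdsTrace h ξ) (𝓝 (T.limitMap h ξ)) := by
  have h1 := ((T.continuous_limitMap h).tendsto ξ).comp (tendsto_nhdsTrace h ξ)
  refine h1.congr fun x => T.limitMap_coe h x

theorem limitMap_mem {ξ : HypCompletion h} (hξ : ξ ∈ HypBoundary h) :
    T.limitMap h ξ ∈ T.limitSet := by
  intro N
  have hcl : IsClosed (⋃ v ∈ {v | T.lev v = N}, T.cell v) :=
    (T.finite_level N).isClosed_biUnion fun v _ => T.cell_closed v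
  have := hcl.mem_of_tendsto (T.tendsto_point h ξ) ?_
  · simpa using this
  · filter_upwards [T.eventually_le_lev h hξ N] with x hx
    exact mem_biUnion (show T.anc N x ∈ {v | T.lev v = N} from T.lev_anc hx)
      (T.cell_subset hx (T.point_mem x))

/-- Common source of the continuity of the inverse and of the estimate under (H), which differ only
in how they ensure that the cells meet. -/
theorem eventually_rho_le {ξ η : HypCompletion h} (hξ : ξ ∈ HypBoundary h)
    (hη : η ∈ HypBoundary h) {N : ℕ} {U W : Set X} (hU : U ∈ 𝓝 (T.limitMap h ξ))
    (hW : W ∈ 𝓝 (T.limitMap h η))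
    (hUW : ∀ u v, T.lev u = N → T.lev v = N → (T.cell u ∩ U).Nonempty → (T.cell v ∩ W).Nonempty →
      (T.cell u ∩ T.cell v).Nonempty) :
    ∀ᶠ p in nhdsTrace h ξ ×ˢ nhdsTrace h η, rho G o a p.1 p.2 ≤ Real.exp (-a * (N - 1 / 2)) := by
  filter_upwards [prod_mem_prod (inter_mem (T.eventually_le_lev h hξ N) (T.tendsto_point h ξ hU))
    (inter_mem (T.eventually_le_lev h hη N) (T.tendsto_point h η hW))]
  rintro ⟨x, y⟩ ⟨⟨hx, hxU⟩, ⟨hy, hyW⟩⟩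
  exact T.rho_le_of_inter h.pos hx hy (hUW _ _ (T.lev_anc hx) (T.lev_anc hy)
    ⟨_, T.cell_subset hx (T.point_mem x), hxU⟩ ⟨_, T.cell_subset hy (T.point_mem y), hyW⟩)

/-- Cells of level `N` meeting `U` all contain the limit point of `η`, so any two of them meet; no
separation condition is needed. -/
theorem exists_nhds_rho_le {η : HypCompletion h} (hη : η ∈ HypBoundary h) (N : ℕ) :
    ∃ U ∈ 𝓝 (T.limitMap h η), ∀ ξ ∈ HypBoundary h, T.limitMap h ξ ∈ U →
      ∀ᶠ p in nhdsTrace h ξ ×ˢ nhdsTrace h η,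
        rho G o a p.1 p.2 ≤ Real.exp (-a * (N - 1 / 2)) := by
  obtain ⟨U, hU, hUo, hUv⟩ := T.exists_nhds_mem_cell (T.limitMap h η) N
  refine ⟨U, hU, fun ξ hξ hξU => T.eventually_rho_le h hξ hη (hUo.mem_nhds hξU) hU ?_⟩
  rintro u v hu hv ⟨y, hyu, hyU⟩ ⟨y', hyv, hyU'⟩
  exact ⟨_, hUv u hu y hyU hyu, hUv v hv y' hyU' hyv⟩

/-- Choose a vertex at each level whose cell contains `z`. Ancestors of any two of them share `z`,
so the sequence is Cauchy. -/
theorem exists_limitMap_eq {z : X} (hz : z ∈ T.limitSet) :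
    ∃ ξ ∈ HypBoundary h, T.limitMap h ξ = z := by
  choose v hv hzv using hz
  have hcell : ∀ N M, N ≤ M → z ∈ T.cell (T.anc N (v M)) := fun N M hNM =>
    T.cell_subset (by rw [hv]; exact hNM) (hzv M)
  have hrho : ∀ N M M', N ≤ M → N ≤ M' → rho G o a (v M) (v M') ≤ Real.exp (-a * (N - 1 / 2)) :=
    fun N M M' hM hM' => T.rho_le_of_inter h.pos (by rw [hv]; exact hM) (by rw [hv]; exact hM')
      ⟨z, hcell N M hM, hcell N M' hM'⟩
  have hcauchy : @CauchySeq (RhoSpace h) ℕ _ _ v := by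
    refine (uniformity_rhoSpace_basis h).cauchySeq_iff.2 fun ε hε => ?_
    obtain ⟨N, hN⟩ := exists_exp_lt h.pos hε
    exact ⟨N, fun M hM M' hM' => (hrho N M M' hM hM').trans_lt (hN N le_rfl)⟩
  obtain ⟨ξ, hξ⟩ := cauchySeq_tendsto_of_complete
    ((Completion.uniformContinuous_coe (RhoSpace h)).comp_cauchySeq hcauchy)
  have hξ' : Tendsto (fun N => toHypCompletion h (v N)) atTop (𝓝 ξ) := hξ
  refine ⟨ξ, ?_, ?_⟩
  -- The limit is not a vertex, since vertices are isolated while the levels of `v N` are unbounded.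
  · rintro ⟨x, rfl⟩
    have h1 : @Tendsto ℕ (RhoSpace h) v atTop (𝓝 x) :=
      (Completion.isUniformInducing_coe (RhoSpace h)).isInducing.tendsto_nhds_iff.2 hξ'
    have h2 := (nhds_basis_uniformity' (uniformity_rhoSpace_basis h)).tendsto_right_iff.1 h1
      (Real.exp (-a * T.lev x)) (Real.exp_pos _)
    obtain ⟨N, hN, hN'⟩ := (h2.and (eventually_gt_atTop (T.lev x))).exists
    have hne : x ≠ v N := by
      intro he
      rw [he, hv] at hN'
      exact lt_irrefl _ hN'
    exact absurd (show rho G o a x (v N) < _ from hN) (not_lt.2 (T.le_rho_of_ne h.pos hne))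
  · have h1 : Tendsto (fun N => T.point (v N)) atTop (𝓝 (T.limitMap h ξ)) :=
      (((T.continuous_limitMap h).tendsto ξ).comp hξ').congr fun N => T.limitMap_coe h _
    refine tendsto_nhds_unique h1 (tendsto_iff_dist_tendsto_zero.2 ?_)
    have h2 : Tendsto (fun N : ℕ => T.D * T.r ^ N) atTop (𝓝 0) := by
      simpa using (tendsto_pow_atTop_nhds_zero_of_lt_one T.r_pos.le T.r_lt_one).const_mul T.D
    refine squeeze_zero (fun _ => dist_nonneg) (fun N => ?_) h2
    have := T.dist_le _ _ (T.point_mem (v N)) _ (hzv N)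
    rwa [hv] at this

/-- The restriction of `limitMap` to the boundary. -/
noncomputable def boundaryMap (ξ : HypBoundary h) : T.limitSet :=
  ⟨T.limitMap h ξ, T.limitMap_mem h ξ.2⟩

/-- Being inducing yields continuity in both directions and, the boundary being a Hausdorff space,
injectivity as well. -/
theorem isInducing_boundaryMap : IsInducing (T.boundaryMap h) := by
  refine isInducing_iff_nhds.2 fun η => le_antisymm ?_ ?_
  · rw [← map_le_iff_le_comap]
    exact (((T.continuous_limitMap h).comp continuous_subtype_val).subtype_mk _).continuousAt
  · intro A hA
    obtain ⟨B, hB, hBA⟩ := mem_nhds_subtype _ _ _ |>.1 hA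
    obtain ⟨S, hS, hSB⟩ := UniformSpace.mem_nhds_iff_symm.1 hB
    obtain ⟨ε, hε, hclose⟩ := exists_rho_lt_of_mem_uniformity h hS
    obtain ⟨N, hN⟩ := exists_exp_lt h.pos hε
    obtain ⟨U, hU, hUr⟩ := T.exists_nhds_rho_le h η.2 N
    refine mem_comap.2 ⟨Subtype.val ⁻¹' U, continuous_subtype_val.continuousAt hU, ?_⟩
    intro ξ hξ
    refine hBA (hSB.2 ?_)
    have := hclose ξ η ((hUr ξ ξ.2 hξ).mono fun p hp => hp.trans_lt (hN N le_rfl))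
    exact hSB.1.symm _ _ this

/-- The homeomorphism of the boundary onto the limit set. -/
noncomputable def boundaryHomeomorph : HypBoundary h ≃ₜ T.limitSet :=
  (Equiv.ofBijective (T.boundaryMap h) ⟨(T.isInducing_boundaryMap h).injective, fun z => by
    obtain ⟨ξ, hξ, hz⟩ := T.exists_limitMap_eq h z.2
    exact ⟨⟨ξ, hξ⟩, Subtype.ext hz⟩⟩).toHomeomorphOfIsInducing (T.isInducing_boundaryMap h)

theorem coe_boundaryHomeomorph (ξ : HypBoundary h) :
    (T.boundaryHomeomorph h ξ : X) = T.limitMap h ξ := rfl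

theorem exists_dist_limitMap_le : ∃ C : ℝ, 0 < C ∧ ∀ ξ η : HypCompletion h,
    dist (T.limitMap h ξ) (T.limitMap h η) ≤ C * rhoExt h ξ η ^ (-Real.log T.r / a) := by
  obtain ⟨C, hC, hp⟩ := T.exists_dist_point_le h
  have hα := T.exponent_pos h.pos
  refine ⟨C, hC, fun ξ η => ?_⟩
  have hlim : Tendsto (fun p : V × V => dist (T.point p.1) (T.point p.2))
      (nhdsTrace h ξ ×ˢ nhdsTrace h η) (𝓝 (dist (T.limitMap h ξ) (T.limitMap h η))) :=
    ((T.tendsto_point h ξ).comp tendsto_fst).dist ((T.tendsto_point h η).comp tendsto_snd)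
  -- The limsup only gives eventual bounds by larger `c`; afterwards `c` decreases to it.
  have hle : ∀ c > rhoExt h ξ η,
      dist (T.limitMap h ξ) (T.limitMap h η) ≤ C * c ^ (-Real.log T.r / a) := fun c hc => by
    refine le_of_tendsto hlim ?_
    filter_upwards [T.eventually_rho_lt_of_rhoExt_lt h hc] with p hpc
    refine (hp _ _).trans ?_
    have := rho_nonneg G o a p.1 p.2
    gcongr
  have hcont : Tendsto (fun c : ℝ => C * c ^ (-Real.log T.r / a)) (𝓝[>] rhoExt h ξ η)
      (𝓝 (C * rhoExt h ξ η ^ (-Real.log T.r / a))) :=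
    (((Real.continuous_rpow_const hα.le).const_mul C).tendsto _).mono_left nhdsWithin_le_nhds
  exact ge_of_tendsto hcont (eventually_mem_nhdsWithin.mono hle)

/-- Compare `s` with the scales `C' * r ^ N`: below such a scale (H) forces the cells of level `N`
to meet, which bounds `ρ_a ^ α` by `r ^ (N - 1 / 2)`. The level just before the first `N` with `C' *
r ^ N ≤ s` gives the estimate. -/
theorem rhoExt_rpow_le {C' : ℝ} (hC' : 0 < C')
    (H : ∀ N : ℕ, 1 ≤ N → ∀ u v, T.lev u = N → T.lev v = N → (T.cell u ∩ T.cell v).Nonempty ∨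
      ∀ x ∈ T.cell u, ∀ y ∈ T.cell v, C' * T.r ^ N ≤ dist x y)
    {ξ η : HypCompletion h} (hξ : ξ ∈ HypBoundary h) (hη : η ∈ HypBoundary h) :
    rhoExt h ξ η ^ (-Real.log T.r / a) ≤
      T.r ^ (-(3 / 2 : ℝ)) / C' * dist (T.limitMap h ξ) (T.limitMap h η) := by
  have hr := T.r_pos
  have hα := T.exponent_pos h.pos
  set s := dist (T.limitMap h ξ) (T.limitMap h η) with hs
  have hs0 : 0 ≤ s := dist_nonneg
  have hclose : ∀ N : ℕ, s < C' * T.r ^ N →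
      rhoExt h ξ η ≤ Real.exp (-a * (N - 1 / 2)) := by
    intro N hN
    apply rhoExt_le
    -- Moving each limit point by less than `e` keeps the distance below `s + 2 * e = C' * r ^ N`.
    set e := (C' * T.r ^ N - s) / 2 with he
    have he0 : 0 < e := by linarith
    refine T.eventually_rho_le h hξ hη (Metric.ball_mem_nhds _ he0) (Metric.ball_mem_nhds _ he0) ?_
    rintro u v hu hv ⟨x, hxu, hx⟩ ⟨y, hyv, hy⟩
    -- The separation hypothesis starts at level `1`; at level `0` the root is the only vertex.
    rcases Nat.eq_zero_or_pos N with rfl | hN1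
    · rw [T.lev_eq_zero] at hu hv
      rw [hu, hv, inter_self]
      exact T.cell_nonempty o
    refine (H N hN1 u v hu hv).resolve_right fun hsep => ?_
    have h1 := hsep x hxu y hyv
    rw [Metric.mem_ball] at hx hy
    have h2 := dist_triangle4 x (T.limitMap h ξ) (T.limitMap h η) y
    rw [dist_comm (T.limitMap h η) y] at h2
    linarith
  -- The power `r ^ (N - 1 / 2)` is split so that `r ^ (N + 1) ≤ s / C'` can be inserted when `N +
  -- 1` is the first failing level.
  have hpow : ∀ N : ℕ, s < C' * T.r ^ N →
      rhoExt h ξ η ^ (-Real.log T.r / a) ≤ T.r ^ (-(3 / 2 : ℝ)) * T.r ^ (N + 1) := by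
    intro N hN
    calc rhoExt h ξ η ^ (-Real.log T.r / a)
        ≤ Real.exp (-a * (N - 1 / 2)) ^ (-Real.log T.r / a) :=
          Real.rpow_le_rpow (T.rhoExt_nonneg h ξ η) (hclose N hN) hα.le
      _ = T.r ^ (-(3 / 2 : ℝ)) * T.r ^ (N + 1) := by
          rw [T.exp_rpow_exponent h.pos, ← Real.rpow_natCast, ← Real.rpow_add hr]
          congr 1
          push_cast
          ring
  have hr1 : 1 ≤ T.r ^ (-(3 / 2 : ℝ)) :=
    Real.one_le_rpow_of_pos_of_le_one_of_nonpos hr T.r_lt_one.le (by norm_num)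
  by_cases hall : ∀ N : ℕ, s < C' * T.r ^ N
  · have hlim : Tendsto (fun N : ℕ => T.r ^ (-(3 / 2 : ℝ)) * T.r ^ (N + 1)) atTop (𝓝 0) := by
      simpa using ((tendsto_pow_atTop_nhds_zero_of_lt_one hr.le T.r_lt_one).comp
        (tendsto_add_atTop_nat 1)).const_mul (T.r ^ (-(3 / 2 : ℝ)))
    exact (ge_of_tendsto' hlim fun N => hpow N (hall N)).trans (by positivity)
  · classical
    push Not at hall
    have hmin := Nat.find_spec hall
    rcases hN : Nat.find hall with _ | N
    -- Here `s ≥ C'`, and the trivial bound `ρ_a ≤ 1` is enough.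
    · rw [hN, pow_zero, mul_one] at hmin
      have h1 : rhoExt h ξ η ≤ 1 := rhoExt_le h
        (Eventually.of_forall fun p => h.rho_le_one T.gromovProduct_nonneg p.1 p.2)
      calc rhoExt h ξ η ^ (-Real.log T.r / a) ≤ 1 :=
            Real.rpow_le_one (T.rhoExt_nonneg h ξ η) h1 hα.le
        _ ≤ s / C' := (one_le_div hC').2 hmin
        _ = 1 / C' * s := by ring
        _ ≤ _ := by gcongr
    · rw [hN] at hmin
      refine (hpow N (not_le.1 (Nat.find_min hall (by omega)))).trans ?_
      rw [div_mul_eq_mul_div, mul_div_assoc]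
      gcongr
      rw [le_div_iff₀ hC']
      linarith

theorem exists_homeomorph : ∃ Φ : HypBoundary h ≃ₜ T.limitSet,
    (∃ C : ℝ, 0 < C ∧ ∀ ξ η : HypBoundary h,
      dist (Φ ξ) (Φ η) ≤ C * rhoExt h ξ η ^ (-Real.log T.r / a)) ∧
    ((∃ C' : ℝ, 0 < C' ∧ ∀ N : ℕ, 1 ≤ N → ∀ u v, T.lev u = N → T.lev v = N →
        (T.cell u ∩ T.cell v).Nonempty ∨ ∀ x ∈ T.cell u, ∀ y ∈ T.cell v, C' * T.r ^ N ≤ dist x y) →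
      ∃ C : ℝ, 0 < C ∧ ∀ ξ η : HypBoundary h,
        C⁻¹ * dist (Φ ξ) (Φ η) ≤ rhoExt h ξ η ^ (-Real.log T.r / a) ∧
        rhoExt h ξ η ^ (-Real.log T.r / a) ≤ C * dist (Φ ξ) (Φ η)) := by
  obtain ⟨C, hC, hle⟩ := T.exists_dist_limitMap_le h
  refine ⟨T.boundaryHomeomorph h, ⟨C, hC, fun ξ η => hle ξ η⟩, ?_⟩
  rintro ⟨C', hC', H⟩
  refine ⟨max C (T.r ^ (-(3 / 2 : ℝ)) / C'), lt_max_of_lt_left hC, fun ξ η => ⟨?_, ?_⟩⟩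
  · rw [inv_mul_le_iff₀ (lt_max_of_lt_left hC)]
    refine (hle ξ η).trans ?_
    have := Real.rpow_nonneg (T.rhoExt_nonneg h ξ η) (-Real.log T.r / a)
    gcongr
    exact le_max_left _ _
  · refine (T.rhoExt_rpow_le h hC' H ξ.2 η.2).trans ?_
    rw [Subtype.dist_eq, coe_boundaryHomeomorph, coe_boundaryHomeomorph]
    gcongr
    exact le_max_right _ _

end CellTree

/-! ### Packing and similarities in finite-dimensional spaces -/

section Euclidean

open MeasureTheory Module

variable {F : Type*} [NormedAddCommGroup F] [NormedSpace ℝ F] [FiniteDimensional ℝ F]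

/-- After rescaling, `S` is an isometry, hence affine by strict convexity, and an injective linear
endomorphism in finite dimension is onto. -/
theorem Dilation.surjective_of_finiteDimensional [StrictConvexSpace ℝ F]
    (S : F →ᵈ F) : Function.Surjective S := by
  have hρ : (0 : ℝ) < Dilation.ratio S := by exact_mod_cast Dilation.ratio_pos S
  have hi : Isometry fun x => (Dilation.ratio S : ℝ)⁻¹ • S x := by
    refine Isometry.of_dist_eq fun x y => ?_
    rw [dist_smul₀, Dilation.dist_eq, Real.norm_of_nonneg (by positivity),
      inv_mul_cancel_left₀ hρ.ne']
  have hs : Function.Surjective hi.affineIsometryOfStrictConvexSpace := by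
    have hinj := hi.affineIsometryOfStrictConvexSpace.injective
    have h1 : Function.Surjective hi.affineIsometryOfStrictConvexSpace.toAffineMap.linear :=
      LinearMap.surjective_of_injective ((AffineMap.linear_injective_iff _).2 hinj)
    exact (AffineMap.linear_surjective_iff _).1 h1
  intro y
  obtain ⟨x, hx⟩ := hs ((Dilation.ratio S : ℝ)⁻¹ • y)
  exact ⟨x, smul_right_injective F (inv_ne_zero hρ.ne') hx⟩

theorem Dilation.ball_subset_image [StrictConvexSpace ℝ F] (S : F →ᵈ F) (q : F)
    (ε : ℝ) : Metric.ball (S q) (Dilation.ratio S * ε) ⊆ S '' Metric.ball q ε := by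
  intro y hy
  obtain ⟨x, rfl⟩ := S.surjective_of_finiteDimensional y
  have hρ : (0 : ℝ) < Dilation.ratio S := by exact_mod_cast Dilation.ratio_pos S
  rw [Metric.mem_ball, Dilation.dist_eq] at hy
  exact ⟨x, lt_of_mul_lt_mul_left hy hρ.le, rfl⟩

/-- Disjoint balls of radius `ρ` inside a ball of radius `m ρ` number at most `m ^ dim`. -/
theorem card_le_of_disjoint_balls {ι : Type*} (s : Finset ι) (c : ι → F) (p : F)
    {ρ m : ℝ} (hρ : 0 < ρ) (hm : 0 < m)
    (hd : (s : Set ι).PairwiseDisjoint fun i => Metric.ball (c i) ρ)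
    (hsub : ∀ i ∈ s, Metric.ball (c i) ρ ⊆ Metric.ball p (m * ρ)) :
    (s.card : ℝ) ≤ m ^ finrank ℝ F := by
  borelize F
  let μ : Measure F := Measure.addHaar
  have h1 : μ (⋃ i ∈ s, Metric.ball (c i) ρ) ≤ μ (Metric.ball p (m * ρ)) :=
    measure_mono (iUnion₂_subset hsub)
  rw [measure_biUnion_finset hd fun i _ => Metric.isOpen_ball.measurableSet,
    Measure.addHaar_ball_mul_of_pos μ p hm] at h1
  simp only [Measure.addHaar_ball_center, Finset.sum_const, nsmul_eq_mul] at h1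
  have h0 : μ (Metric.ball 0 ρ) ≠ 0 := (Metric.measure_ball_pos μ 0 hρ).ne'
  rw [ENNReal.mul_le_mul_iff_left h0 measure_ball_lt_top.ne] at h1
  rw [← ENNReal.ofReal_natCast] at h1
  exact (ENNReal.ofReal_le_ofReal_iff (by positivity)).1 h1

end Euclidean

/-! ### Words and levels -/

section Words

variable {n : ℕ → ℕ} {rat : ℕ → ℝ}

/-- The prefix of length `m` of a word. -/
def MoranWord.take {k : ℕ} (w : MoranWord n k) {m : ℕ} (hm : m ≤ k) : MoranWord n m :=
  fun j => w (Fin.castLE hm j)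

theorem MoranWord.append_init {k : ℕ} (w : MoranWord n (k + 1)) :
    (w.take (Nat.le_succ k)).append (w (Fin.last k)) = w :=
  Fin.snoc_init_self w

theorem IsWordPrefix.take {u : Σ k, MoranWord n k} {m : ℕ} (hm : m ≤ u.1) :
    IsWordPrefix ⟨m, u.2.take hm⟩ u := ⟨hm, fun _ => rfl⟩

theorem IsWordPrefix.trans {u v w : Σ k, MoranWord n k} (h : IsWordPrefix u v)
    (h' : IsWordPrefix v w) : IsWordPrefix u w :=
  ⟨h.1.trans h'.1, fun j => (h'.2 (Fin.castLE h.1 j)).trans (h.2 j)⟩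

theorem IsWordPrefix.refl (u : Σ k, MoranWord n k) : IsWordPrefix u u := ⟨le_rfl, fun _ => rfl⟩

theorem IsWordPrefix.unique {u v w : Σ k, MoranWord n k} (hu : IsWordPrefix u w)
    (hv : IsWordPrefix v w) (h : u.1 = v.1) : u = v := by
  obtain ⟨k, u⟩ := u
  obtain ⟨l, v⟩ := v
  obtain rfl : k = l := h
  congr 1
  ext j : 1
  exact (hu.2 j).symm.trans (hv.2 j)

/-- The standing assumptions on the number of letters and the ratios. -/
structure IsMoranRatio (n : ℕ → ℕ) (rat : ℕ → ℝ) : Prop where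
  two_le : ∀ k, 2 ≤ n k
  pos : ∀ k, 0 < rat k
  mul_le : ∀ k, (n k : ℝ) * rat k ≤ 1
  ratInf_pos : 0 < ratInf rat

namespace IsMoranRatio

variable (hR : IsMoranRatio n rat)

theorem le_half (hR : IsMoranRatio n rat) (k : ℕ) : rat k ≤ 1 / 2 := by
  have h1 : (2 : ℝ) ≤ n k := by exact_mod_cast hR.two_le k
  nlinarith [hR.pos k, hR.mul_le k]

theorem ratInf_le (hR : IsMoranRatio n rat) (k : ℕ) : ratInf rat ≤ rat k :=
  ciInf_le ⟨0, by rintro _ ⟨j, rfl⟩; exact (hR.pos j).le⟩ k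

theorem ratInf_lt_one (hR : IsMoranRatio n rat) : ratInf rat < 1 :=
  (hR.ratInf_le 0).trans_lt ((hR.le_half 0).trans_lt (by norm_num))

theorem ratProd_pos (hR : IsMoranRatio n rat) (k : ℕ) : 0 < ratProd rat k :=
  Finset.prod_pos fun j _ => hR.pos j

theorem ratProd_strictAnti (hR : IsMoranRatio n rat) : StrictAnti (ratProd rat) := by
  refine strictAnti_nat_of_succ_lt fun k => ?_
  rw [ratProd, Finset.prod_range_succ, ← ratProd]
  have := hR.ratProd_pos k
  have := hR.le_half k
  nlinarith

theorem exists_ratProd_le (hR : IsMoranRatio n rat) (N : ℕ) :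
    ∃ k, ratProd rat k ≤ ratInf rat ^ N := by
  obtain ⟨k, hk⟩ := exists_pow_lt_of_lt_one (pow_pos hR.ratInf_pos N)
    (show (1 / 2 : ℝ) < 1 by norm_num)
  refine ⟨k, le_trans ?_ hk.le⟩
  calc ratProd rat k ≤ ∏ _j ∈ Finset.range k, (1 / 2 : ℝ) :=
        Finset.prod_le_prod (fun j _ => (hR.pos j).le) fun j _ => hR.le_half j
    _ = (1 / 2) ^ k := by simp

open Classical in
/-- The common length of the words of level `N`. -/
noncomputable def length (hR : IsMoranRatio n rat) (N : ℕ) : ℕ := Nat.find (hR.exists_ratProd_le N)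

theorem ratProd_length_le (N : ℕ) : ratProd rat (hR.length N) ≤ ratInf rat ^ N := by
  classical exact Nat.find_spec (hR.exists_ratProd_le N)

theorem lt_ratProd {N k : ℕ} (hk : k < hR.length N) : ratInf rat ^ N < ratProd rat k := by
  classical exact not_le.1 (Nat.find_min (hR.exists_ratProd_le N) hk)

/-- The product first drops to `r ^ N` or below by one factor, which is at least `r`. Cells of level
`N` are therefore not much smaller than `r ^ N`, as the packing bound requires. -/
theorem lt_ratProd_length (N : ℕ) : ratInf rat ^ (N + 1) < ratProd rat (hR.length N) := by
  rcases hk : hR.length N with _ | k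
  · rw [ratProd, Finset.prod_range_zero]
    exact pow_lt_one₀ hR.ratInf_pos.le hR.ratInf_lt_one (Nat.succ_ne_zero N)
  · rw [ratProd, Finset.prod_range_succ, ← ratProd, pow_succ]
    exact mul_lt_mul (hR.lt_ratProd (by omega)) (hR.ratInf_le k) hR.ratInf_pos
      (hR.ratProd_pos k).le

theorem length_strictMono : StrictMono hR.length := by
  refine strictMono_nat_of_lt_succ fun N => ?_
  by_contra! hle
  exact absurd ((hR.ratProd_strictAnti.antitone hle).trans (hR.ratProd_length_le (N + 1)))
    (not_le.2 (hR.lt_ratProd_length N))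

theorem length_zero : hR.length 0 = 0 := by
  by_contra hne
  have := hR.lt_ratProd (Nat.pos_of_ne_zero hne)
  simp [ratProd] at this

/-- The products strictly decrease, so exactly one length satisfies both inequalities. -/
theorem mem_moranLevel_iff {N : ℕ} {w : Σ k, MoranWord n k} :
    w ∈ moranLevel n rat N ↔ w.1 = hR.length N := by
  constructor
  · rintro ⟨h1, h2⟩
    apply le_antisymm
    · by_contra! hlt
      exact absurd ((hR.ratProd_strictAnti.antitone (show hR.length N ≤ w.1 - 1 by omega)).trans
        (hR.ratProd_length_le N)) (not_le.2 (h2 (by omega)))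
    · by_contra! hlt
      exact absurd h1 (not_le.2 (hR.lt_ratProd hlt))
  · intro h
    refine ⟨h ▸ hR.ratProd_length_le N, fun hpos => hR.lt_ratProd (by omega)⟩

/-- The level of a vertex. -/
noncomputable def lev (v : MoranVertex n rat) : ℕ := v.2.choose

theorem mem_level_iff (hR : IsMoranRatio n rat) {N : ℕ} {v : MoranVertex n rat} :
    v.1 ∈ moranLevel n rat N ↔ lev v = N := by
  constructor
  · intro h
    have h1 := v.2.choose_spec
    rw [hR.mem_moranLevel_iff] at h h1
    exact hR.length_strictMono.injective (h1.symm.trans h)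
  · rintro rfl
    exact v.2.choose_spec

theorem fst_eq_length (v : MoranVertex n rat) : v.1.1 = hR.length (lev v) :=
  hR.mem_moranLevel_iff.1 (hR.mem_level_iff.2 rfl)

theorem lev_eq_of_fst {N : ℕ} {v : MoranVertex n rat} (h : v.1.1 = hR.length N) : lev v = N :=
  hR.mem_level_iff.1 (hR.mem_moranLevel_iff.2 h)

/-- The vertex given by a word of the length of level `N`. -/
noncomputable def vertex (N : ℕ) (w : MoranWord n (hR.length N)) : MoranVertex n rat :=
  ⟨⟨hR.length N, w⟩, N, hR.mem_moranLevel_iff.2 rfl⟩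

theorem lev_vertex (N : ℕ) (w : MoranWord n (hR.length N)) : lev (hR.vertex N w) = N :=
  hR.lev_eq_of_fst rfl

theorem length_le_of_le_lev {N : ℕ} {v : MoranVertex n rat} (h : N ≤ lev v) :
    hR.length N ≤ v.1.1 := hR.fst_eq_length v ▸ hR.length_strictMono.monotone h

/-- The ancestor of level `N` of a vertex. -/
noncomputable def anc (N : ℕ) (v : MoranVertex n rat) : MoranVertex n rat :=
  if h : N ≤ lev v then hR.vertex N (v.1.2.take (hR.length_le_of_le_lev h)) else v

theorem lev_anc {N : ℕ} {v : MoranVertex n rat} (h : N ≤ lev v) : lev (hR.anc N v) = N := by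
  rw [anc, dif_pos h, lev_vertex]

theorem isWordPrefix_anc {N : ℕ} {v : MoranVertex n rat} (h : N ≤ lev v) :
    IsWordPrefix (hR.anc N v).1 v.1 := by
  rw [anc, dif_pos h]
  exact IsWordPrefix.take _

theorem eq_of_prefix (hR : IsMoranRatio n rat) {u v w : MoranVertex n rat}
    (hu : IsWordPrefix u.1 w.1)
    (hv : IsWordPrefix v.1 w.1) (h : lev u = lev v) : u = v :=
  Subtype.ext (hu.unique hv (by rw [hR.fst_eq_length, hR.fst_eq_length, h]))

theorem anc_eq {N : ℕ} {u v : MoranVertex n rat} (hN : N ≤ lev v) (hu : IsWordPrefix u.1 v.1)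
    (h : lev u = N) : hR.anc N v = u :=
  hR.eq_of_prefix (hR.isWordPrefix_anc hN) hu (by rw [hR.lev_anc hN, h])

theorem lev_eq_zero_iff (hR : IsMoranRatio n rat) (v : MoranVertex n rat) :
    lev v = 0 ↔ v = moranRoot n rat := by
  constructor
  · intro h
    have h1 := hR.fst_eq_length v
    rw [h, hR.length_zero] at h1
    refine Subtype.ext (IsWordPrefix.unique (IsWordPrefix.refl _) ⟨?_, fun j => j.elim0⟩ h1)
    exact Nat.zero_le _
  · rintro rfl
    exact hR.lev_eq_of_fst hR.length_zero.symm

theorem finite_level (hR : IsMoranRatio n rat) (N : ℕ) :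
    {v : MoranVertex n rat | lev v = N}.Finite := by
  refine (finite_range (hR.vertex N)).subset fun v hv => ?_
  obtain ⟨⟨k, w⟩, hw⟩ := v
  obtain rfl : k = hR.length N := by
    rw [← show lev _ = N from hv]
    exact hR.fst_eq_length ⟨⟨k, w⟩, hw⟩
  exact ⟨w, rfl⟩

theorem moranVertical_iff (u v : MoranVertex n rat) :
    MoranVertical u v ↔ lev v = lev u + 1 ∧ hR.anc (lev u) v = u := by
  constructor
  · rintro ⟨N, hu, hv, hp⟩
    rw [hR.mem_level_iff] at hu hv
    exact ⟨by omega, hR.anc_eq (by omega) hp rfl⟩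
  · rintro ⟨h1, h2⟩
    refine ⟨lev u, hR.mem_level_iff.2 rfl, hR.mem_level_iff.2 h1, ?_⟩
    have := hR.isWordPrefix_anc (N := lev u) (v := v) (by omega)
    rwa [h2] at this

end IsMoranRatio

end Words

/-! ### The Moran structure as a tree of cells -/

section Moran

variable {d : ℕ} {J₀ : Set (EuclideanSpace ℝ (Fin d))} {n : ℕ → ℕ} {rat : ℕ → ℝ}
  {J : (k : ℕ) → MoranWord n k → Set (EuclideanSpace ℝ (Fin d))}

open IsMoranRatio

/-- Positivity of the level is automatic, because level `0` has no two distinct vertices. -/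
theorem IsMoranRatio.moranHorizontal_iff (hR : IsMoranRatio n rat) (u v : MoranVertex n rat) :
    MoranHorizontal J u v ↔
      u ≠ v ∧ lev u = lev v ∧ (J u.1.1 u.1.2 ∩ J v.1.1 v.1.2).Nonempty := by
  constructor
  · rintro ⟨hne, N, -, hu, hv, hi⟩
    rw [hR.mem_level_iff] at hu hv
    exact ⟨hne, hu.trans hv.symm, hi⟩
  · rintro ⟨hne, hl, hi⟩
    refine ⟨hne, lev u, Nat.pos_of_ne_zero fun h0 => hne ?_, hR.mem_level_iff.2 rfl,
      hR.mem_level_iff.2 hl.symm, hi⟩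
    rw [(hR.lev_eq_zero_iff u).1 h0, (hR.lev_eq_zero_iff v).1 (hl ▸ h0)]

theorem IsMoranRatio.augmentedTree_adj_iff (hR : IsMoranRatio n rat) (u v : MoranVertex n rat) :
    (augmentedTree rat J).Adj u v ↔ (lev v = lev u + 1 ∧ hR.anc (lev u) v = u) ∨
      (lev u = lev v + 1 ∧ hR.anc (lev v) u = v) ∨
      (u ≠ v ∧ lev u = lev v ∧ (J u.1.1 u.1.2 ∩ J v.1.1 v.1.2).Nonempty) := by
  rw [augmentedTree, SimpleGraph.fromRel_adj, hR.moranVertical_iff, hR.moranVertical_iff,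
    hR.moranHorizontal_iff, hR.moranHorizontal_iff]
  constructor
  · rintro ⟨-, (h | h) | (h | h)⟩
    · exact Or.inl h
    · exact Or.inr (Or.inr h)
    · exact Or.inr (Or.inl h)
    · exact Or.inr (Or.inr ⟨h.1.symm, h.2.1.symm, by rw [inter_comm]; exact h.2.2⟩)
  · rintro (h | h | h)
    · refine ⟨?_, Or.inl (Or.inl h)⟩
      rintro rfl
      omega
    · refine ⟨?_, Or.inr (Or.inl h)⟩
      rintro rfl
      omega
    · exact ⟨h.1, Or.inl (Or.inr h)⟩

namespace IsMoranStructure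

theorem subset_take (hJ : IsMoranStructure J₀ n rat J) {k : ℕ} (w : MoranWord n k) {m : ℕ}
    (hm : m ≤ k) : J k w ⊆ J m (w.take hm) := by
  induction k with
  | zero =>
    obtain rfl : m = 0 := by omega
    exact subset_rfl
  | succ k ih =>
    rcases Nat.lt_or_ge k m with h | h
    · obtain rfl : m = k + 1 := by omega
      exact subset_rfl
    · have h1 := hJ.subset k (w.take (Nat.le_succ k)) (w (Fin.last k))
      rw [w.append_init] at h1
      exact h1.trans (ih (w.take (Nat.le_succ k)) h)

theorem subset_of_prefix (hJ : IsMoranStructure J₀ n rat J) {u v : Σ k, MoranWord n k}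
    (h : IsWordPrefix u v) : J v.1 v.2 ⊆ J u.1 u.2 := by
  have h1 := hJ.subset_take v.2 h.1
  have h2 : v.2.take h.1 = u.2 := funext fun j => h.2 j
  rwa [h2] at h1

/-- The Moran structure speaks only of siblings; other pairs inherit disjointness from distinct
prefixes. -/
theorem disjoint_interior (hJ : IsMoranStructure J₀ n rat J) {k : ℕ} {w w' : MoranWord n k}
    (hne : w ≠ w') : Disjoint (interior (J k w)) (interior (J k w')) := by
  induction k with
  | zero => exact absurd (funext fun j => j.elim0) hne
  | succ k ih =>
    by_cases hi : w.take (Nat.le_succ k) = w'.take (Nat.le_succ k)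
    · have hl : w (Fin.last k) ≠ w' (Fin.last k) := by
        intro hl
        apply hne
        rw [← w.append_init, ← w'.append_init, hi, hl]
      have := hJ.disjoint k (w.take (Nat.le_succ k)) _ _ hl
      rw [w.append_init, hi, w'.append_init] at this
      exact this
    · exact (ih hi).mono (interior_mono (hJ.subset_take w _)) (interior_mono (hJ.subset_take w' _))

theorem diam_eq (hJ : IsMoranStructure J₀ n rat J) (hR : IsMoranRatio n rat) {k : ℕ}
    (w : MoranWord n k) : Metric.diam (J k w) = ratProd rat k * Metric.diam J₀ := by
  induction k with
  | zero => rw [hJ.root]; simp [ratProd]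
  | succ k ih =>
    have h1 := hJ.ratio k (w.take (Nat.le_succ k)) (w (Fin.last k))
    rw [w.append_init] at h1
    -- With division by zero equal to `0`, the positive ratio excludes a parent of diameter zero.
    have h2 : Metric.diam (J k (w.take (Nat.le_succ k))) ≠ 0 := by
      intro h0
      rw [h0, div_zero] at h1
      exact (hR.pos k).ne h1
    rw [div_eq_iff h2, ih] at h1
    rw [h1, ratProd, ratProd, Finset.prod_range_succ]
    ring

theorem diam_pos (hJ : IsMoranStructure J₀ n rat J) (hR : IsMoranRatio n rat) :
    0 < Metric.diam J₀ := by
  refine Metric.diam_nonneg.lt_of_ne fun h0 => ?_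
  have h1 := hJ.ratio 0 (fun j => j.elim0) ⟨0, by linarith [hR.two_le 0]⟩
  rw [hJ.root, ← h0, div_zero] at h1
  exact (hR.pos 0).ne h1

theorem exists_ball_subset (hJ : IsMoranStructure J₀ n rat J) (hR : IsMoranRatio n rat)
    (hJi : (interior J₀).Nonempty) : ∃ ε : ℝ, 0 < ε ∧ ∀ (k : ℕ) (w : MoranWord n k),
      ∃ c, Metric.ball c (ratProd rat k * ε) ⊆ J k w := by
  obtain ⟨q, hq⟩ := hJi
  obtain ⟨ε, hε, hsub⟩ := Metric.mem_nhds_iff.1 (mem_interior_iff_mem_nhds.1 hq)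
  refine ⟨ε, hε, fun k w => ?_⟩
  obtain ⟨S, hS⟩ := hJ.similar k w
  have h1 : (Dilation.ratio S : ℝ) = ratProd rat k := by
    have := hJ.diam_eq hR w
    rw [hS, Dilation.diam_image] at this
    exact mul_right_cancel₀ (hJ.diam_pos hR).ne' this
  refine ⟨S q, ?_⟩
  rw [← h1, hS]
  exact (S.ball_subset_image q ε).trans (image_mono hsub)

theorem isCompact (hJ : IsMoranStructure J₀ n rat J) (hJc : IsCompact J₀) {k : ℕ}
    (w : MoranWord n k) : IsCompact (J k w) := by
  obtain ⟨S, hS⟩ := hJ.similar k w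
  rw [hS]
  exact hJc.image (Dilation.lipschitz S).continuous

theorem nonempty (hJ : IsMoranStructure J₀ n rat J) (hJi : (interior J₀).Nonempty) {k : ℕ}
    (w : MoranWord n k) : (J k w).Nonempty := by
  obtain ⟨S, hS⟩ := hJ.similar k w
  rw [hS]
  exact (hJi.mono interior_subset).image S

theorem dist_le (hJ : IsMoranStructure J₀ n rat J) (hR : IsMoranRatio n rat) (hJc : IsCompact J₀)
    (v : MoranVertex n rat) {x y : EuclideanSpace ℝ (Fin d)} (hx : x ∈ J v.1.1 v.1.2)
    (hy : y ∈ J v.1.1 v.1.2) : dist x y ≤ Metric.diam J₀ * ratInf rat ^ lev v := by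
  refine (Metric.dist_le_diam_of_mem (hJ.isCompact hJc _).isBounded hx hy).trans ?_
  rw [hJ.diam_eq hR, mul_comm]
  have h1 := hR.ratProd_length_le (lev v)
  rw [← hR.fst_eq_length] at h1
  have := Metric.diam_nonneg (s := J₀)
  gcongr

/-- Cells of one level have disjoint interiors, and each contains a ball of radius `r ^ (N + 1) *
ε`. Those near `p` lie in a ball of comparable radius, so volume bounds their number independently
of `N`. -/
theorem exists_packing_bound (hJ : IsMoranStructure J₀ n rat J) (hR : IsMoranRatio n rat)
    (hJc : IsCompact J₀) (hJi : (interior J₀).Nonempty) :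
    ∃ K : ℕ, ∀ (N : ℕ) (p : EuclideanSpace ℝ (Fin d)) (s : Finset (MoranVertex n rat)),
      (∀ v ∈ s, lev v = N ∧ ∃ x ∈ J v.1.1 v.1.2, dist p x ≤ Metric.diam J₀ * ratInf rat ^ N) →
        s.card ≤ K := by
  obtain ⟨ε, hε, hball⟩ := hJ.exists_ball_subset hR hJi
  have hD := hJ.diam_pos hR
  have hr := hR.ratInf_pos
  set D := Metric.diam J₀
  -- The cells in question lie within `2 * D * r ^ N` of `p`; the factor `3` leaves room for an open
  -- ball.
  set m : ℝ := 3 * D / (ratInf rat * ε) with hm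
  refine ⟨⌈m ^ Module.finrank ℝ (EuclideanSpace ℝ (Fin d))⌉₊, fun N p s hs => ?_⟩
  choose c hc using fun v : MoranVertex n rat => hball v.1.1 v.1.2
  have hsub : ∀ v ∈ s, Metric.ball (c v) (ratInf rat ^ (N + 1) * ε) ⊆ J v.1.1 v.1.2 := by
    intro v hv
    refine (Metric.ball_subset_ball ?_).trans (hc v)
    rw [hR.fst_eq_length, (hs v hv).1]
    have := (hR.lt_ratProd_length N).le
    gcongr
  refine Nat.cast_le.1 (le_trans (card_le_of_disjoint_balls s c p
    (ρ := ratInf rat ^ (N + 1) * ε) (m := m) (by positivity) (by positivity) ?_ ?_)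
    (Nat.le_ceil _))
  · intro u hu v hv huv
    have hlen : u.1.1 = v.1.1 := by
      rw [hR.fst_eq_length, hR.fst_eq_length, (hs u hu).1, (hs v hv).1]
    have hdis : Disjoint (interior (J u.1.1 u.1.2)) (interior (J v.1.1 v.1.2)) := by
      obtain ⟨⟨k, u⟩, hu'⟩ := u
      obtain ⟨⟨l, v⟩, hv'⟩ := v
      obtain rfl : k = l := hlen
      refine hJ.disjoint_interior fun he => huv ?_
      obtain rfl : u = v := he
      rfl
    exact hdis.mono (interior_maximal (hsub u hu) Metric.isOpen_ball)
      (interior_maximal (hsub v hv) Metric.isOpen_ball)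
  · intro v hv y hy
    obtain ⟨hl, x, hx, hpx⟩ := hs v hv
    have h1 := hJ.dist_le hR hJc v hx (hsub v hv hy)
    rw [hl] at h1
    have h2 : m * (ratInf rat ^ (N + 1) * ε) = 3 * (D * ratInf rat ^ N) := by
      rw [hm, pow_succ]
      field_simp
    have h3 : 0 < D * ratInf rat ^ N := by positivity
    rw [Metric.mem_ball, dist_comm, h2]
    linarith [dist_triangle p x y]

/-- The tree of cells of a Moran structure. -/
noncomputable def cellTree (hJ : IsMoranStructure J₀ n rat J) (hR : IsMoranRatio n rat)
    (hJc : IsCompact J₀) (hJi : (interior J₀).Nonempty) :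
    CellTree (augmentedTree rat J) (moranRoot n rat) (EuclideanSpace ℝ (Fin d)) where
  lev := lev
  anc := hR.anc
  cell v := J v.1.1 v.1.2
  r := ratInf rat
  D := Metric.diam J₀
  K := (hJ.exists_packing_bound hR hJc hJi).choose
  r_pos := hR.ratInf_pos
  r_lt_one := hR.ratInf_lt_one
  lev_eq_zero := hR.lev_eq_zero_iff
  lev_anc := hR.lev_anc
  anc_lev v := hR.anc_eq le_rfl (IsWordPrefix.refl _) rfl
  anc_anc {N M v} h h' := by
    have h1 : N ≤ lev (hR.anc M v) := by rwa [hR.lev_anc h']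
    exact (hR.anc_eq (h.trans h') ((hR.isWordPrefix_anc h1).trans (hR.isWordPrefix_anc h'))
      (hR.lev_anc h1)).symm
  cell_subset h := hJ.subset_of_prefix (hR.isWordPrefix_anc h)
  cell_nonempty v := hJ.nonempty hJi _
  cell_closed v := (hJ.isCompact hJc _).isClosed
  finite_level := hR.finite_level
  adj_iff := hR.augmentedTree_adj_iff
  dist_le v x hx y hy := hJ.dist_le hR hJc v hx hy
  packing := (hJ.exists_packing_bound hR hJc hJi).choose_spec

/-- The limit set uses only the word lengths of the levels. These are cofinal, as `k ≤ hR.length k`,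
and prefixes supply the remaining lengths. -/
theorem limitSet_cellTree (hJ : IsMoranStructure J₀ n rat J) (hR : IsMoranRatio n rat)
    (hJc : IsCompact J₀) (hJi : (interior J₀).Nonempty) :
    (hJ.cellTree hR hJc hJi).limitSet = moranSet J := by
  ext z
  rw [moranSet, mem_iInter]
  constructor
  · intro hz k
    obtain ⟨v, hv, hzv⟩ := hz k
    have hk : k ≤ v.1.1 := by
      rw [hR.fst_eq_length, show lev v = k from hv]
      exact hR.length_strictMono.id_le k
    exact mem_iUnion.2 ⟨v.1.2.take hk, hJ.subset_take v.1.2 hk hzv⟩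
  · intro hz N
    obtain ⟨w, hw⟩ := mem_iUnion.1 (hz (hR.length N))
    exact ⟨hR.vertex N w, hR.lev_vertex N w, hw⟩

end IsMoranStructure

end Moran

/-! ### The theorem for Moran sets. -/

theorem theorem1p2 {d : ℕ} (J₀ : Set (EuclideanSpace ℝ (Fin d))) (hJc : IsCompact J₀)
    (hJi : (interior J₀).Nonempty) (n : ℕ → ℕ) (rat : ℕ → ℝ)
    (hn : ∀ k, 2 ≤ n k) (hrat0 : ∀ k, 0 < rat k) (hrat1 : ∀ k, rat k < 1)
    (hnr : ∀ k, (n k : ℝ) * rat k ≤ 1) (hr : 0 < ratInf rat)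
    (J : (k : ℕ) → MoranWord n k → Set (EuclideanSpace ℝ (Fin d)))
    (hJ : IsMoranStructure J₀ n rat J) :
    IsHyperbolicGraph (augmentedTree rat J) (moranRoot n rat) ∧
    ∀ (δ a : ℝ) (h : AdmissibleParam (augmentedTree rat J) (moranRoot n rat) δ a),
      ∃ Φ : HypBoundary h ≃ₜ moranSet J,
        (∃ C : ℝ, 0 < C ∧ ∀ ξ η : HypBoundary h,
          dist (Φ ξ) (Φ η) ≤ C * rhoExt h ξ η ^ (-Real.log (ratInf rat) / a)) ∧
        (ConditionH rat J → ∃ C : ℝ, 0 < C ∧ ∀ ξ η : HypBoundary h,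
          C⁻¹ * dist (Φ ξ) (Φ η) ≤ rhoExt h ξ η ^ (-Real.log (ratInf rat) / a) ∧
          rhoExt h ξ η ^ (-Real.log (ratInf rat) / a) ≤ C * dist (Φ ξ) (Φ η)) := by
  have hR : IsMoranRatio n rat := ⟨hn, hrat0, hnr, hr⟩
  refine ⟨(hJ.cellTree hR hJc hJi).isHyperbolicGraph, fun δ a h => ?_⟩
  have key := (hJ.cellTree hR hJc hJi).exists_homeomorph h
  rw [hJ.limitSet_cellTree hR hJc hJi] at key
  obtain ⟨Φ, hΦ, hΦH⟩ := key
  refine ⟨Φ, hΦ, ?_⟩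
  rintro ⟨C', hC', H⟩
  exact hΦH ⟨C', hC', fun N hN u v hu hv =>
    H N hN u.1 (hR.mem_level_iff.2 hu) v.1 (hR.mem_level_iff.2 hv)⟩
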